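/- Let $p\neq 2$ be a prime and let $a\in\mathbb{Z}$ be a quadratic non-residue modulo $p$. On $\mathbb{Q}_p^4$, with $\|x\|_p=\max_i|x_i|_p$ and the Haar measure $d^4x$ giving $\mathbb{Z}_p^4$ measure $1$, put $$f(x)=x_1^2-ax_2^2-px_3^2+apx_4^2,\qquad f^{\circ}(\xi)=ap\,\xi_1^2-p\,\xi_2^2-a\,\xi_3^2+\xi_4^2 .$$ Let $\chi(y)=e^{2\pi i\{y\}_p}$ be the standard additive character of $\mathbb{Q}_p$, $\mathcal{F}\varphi(\xi)=\int\chi(-\xi\cdot x)\varphi(x)\,d^4x$ and $\mathcal{F}^{-1}\varphi(x)=\int\chi(\xi\cdot x)\varphi(\xi)\,d^4\xi$. Let $\mathbf{\Psi}$ be the space of locally constant, compactly supported functions $\psi:\mathbb{Q}_p^4\to\mathbb{C}$ with $\psi(0)=0$, let $\mathbf{\Phi}=\mathcal{F}[\mathbf{\Psi}]$ be the Lizorkin space of test functions (of the second kind), and let $\mathbf{\Phi}',\mathbf{\Psi}'$ be the dual spaces, with $\mathcal{F}:\mathbf{\Phi}'\to\mathbf{\Psi}'$, $\langle\mathcal{F}[J],\psi\rangle=\langle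 J,\mathcal{F}[\psi]\rangle$. For real $\alpha>0$ let $$\boldsymbol{f}(\partial,\alpha)\varphi=\mathcal{F}^{-1}\left(|f^{\circ}|_p^{\alpha}\,\mathcal{F}\varphi\right)\ (\varphi\in\mathbf{\Phi}),\qquad \boldsymbol{f}(\partial,\alpha)J=\mathcal{F}^{-1}\left[|f^{\circ}|_p^{\alpha}\,\mathcal{F}[J]\right]\ (J\in\mathbf{\Phi}').$$ A fundamental solution of $\boldsymbol{f}(\partial,\alpha)u=\varphi$ is a distribution $E\in\mathbf{\Phi}'$ such that, for every $\varphi\in\mathbf{\Phi}$, the function $u(x)=(E*\varphi)(x)=\langle E(y),\varphi(x-y)\rangle$ belongs to $\mathbf{\Phi}$ and satisfies $\boldsymbol{f}(\partial,\alpha)u=\varphi$. (i) For every real $\alpha>0$ the function $$E_\alpha(x)=\begin{cases}\dfrac{1-p^{-\alpha}}{1-p^{\alpha-2}}\,|f(x)|_p^{\alpha-2}&\text{if }\alpha\neq2,\\[2ex]-\dfrac{1-p^{-2}}{\ln p}\,\ln|f(x)|_p&\text{if }\alpha=2\end{cases}$$ is locally integrable, and the distribution $\varphi\mapsto\int E_\alpha(x)\varphi(x)\,d^4x$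 in $\mathbf{\Phi}'$ is a fundamental solution of $\boldsymbol{f}(\partial,\alpha)u=\varphi$. (ii) The distribution $\langle|f|_p^s,\varphi\rangle=\int_{f(x)\ne0}|f(x)|_p^s\varphi(x)\,d^4x$ ($\varphi\in\mathbf{\Phi}$, $\operatorname{Re}s>0$) has a meromorphic continuation to all $s\in\mathbb{C}$ as an element of $\mathbf{\Phi}'$, again denoted $|f|_p^s$, which is holomorphic wherever $p^{s+2}\neq1$. As meromorphic functions of $s$ with values in $\mathbf{\Phi}'$, $$\boldsymbol{f}(\partial,1)|f|_p^{s+1}=\frac{(1-p^{s+1})(1-p^{-s-2})}{(1-p^{-s-3})(1-p^{s})}\,|f|_p^{s}.$$ That is, equality holds in $\mathbf{\Phi}'$ for every $s\in\mathbb{C}$ with $p^{s}\neq1$, $p^{s+2}\neq1$, $p^{s+3}\neq1$; and for every $s_0$ with $p^{s_0+3}\neq1$ and every $\varphi\in\mathbf{\Phi}$, the right-hand side applied to $\varphi$ tends to $\langle\boldsymbol{f}(\partial,1)|f|_p^{s_0+1},\varphi\rangle$ as $s\to s_0$, $s\neq s_0$. -/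

import Mathlib

open MeasureTheory Filter Topology Metric
open scoped NNReal ENNReal

noncomputable section

namespace PadicRiesz

/-! ## The additive character of `ℚ_p` -/

section Character

variable {p : ℕ} [Fact p.Prime]

theorem norm_pow_mul_le_one (x : ℚ_[p]) :
    ‖(p : ℚ_[p]) ^ (-x.valuation).toNat * x‖ ≤ 1 := by
  rcases eq_or_ne x 0 with rfl | hx
  · simp
  have hp1 : (1 : ℝ) < p := by exact_mod_cast (Fact.out : p.Prime).one_lt
  have hp0 : (p : ℝ) ≠ 0 := by positivity
  rw [norm_mul, norm_pow, Padic.norm_p, Padic.norm_eq_zpow_neg_valuation hx, inv_pow,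
    ← zpow_natCast, ← zpow_neg, ← zpow_add₀ hp0]
  apply zpow_le_one_of_nonpos₀ hp1.le
  have := Int.self_le_toNat (-x.valuation)
  omega

/-- The fractional part `{x}_p`: if `ord x = -k < 0` and `x = p^{-k} ∑ x_j p^j` with digits
`0 ≤ x_j < p`, this is `p^{-k} ∑_{j < k} x_j p^j`; it is `0` if `x ∈ ℤ_p`.
(`PadicInt.appr z k` is the sum of the first `k` terms of the digit expansion of `z`.) -/
def fractPart (x : ℚ_[p]) : ℚ :=
  (PadicInt.appr ⟨(p : ℚ_[p]) ^ (-x.valuation).toNat * x, norm_pow_mul_le_one x⟩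
    (-x.valuation).toNat : ℚ) / (p : ℚ) ^ (-x.valuation).toNat

/-- The standard additive character `χ(x) = exp(2 π i {x}_p)` of `ℚ_p`. -/
def chi (x : ℚ_[p]) : ℂ :=
  Complex.exp (2 * Real.pi * Complex.I * ((fractPart x : ℚ) : ℂ))

theorem fractPart_spec (x : ℚ_[p]) :
    (∃ (m : ℤ) (k : ℕ), fractPart x = m / (p : ℚ) ^ k) ∧ ‖x - (fractPart x : ℚ_[p])‖ ≤ 1 := by
  refine ⟨⟨_, (-x.valuation).toNat, by rw [fractPart, Int.cast_natCast]⟩, ?_⟩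
  set k := (-x.valuation).toNat with hk
  set z : ℤ_[p] := ⟨(p : ℚ_[p]) ^ k * x, norm_pow_mul_le_one x⟩ with hz
  have hp0 : (p : ℚ_[p]) ≠ 0 := by exact_mod_cast (Fact.out : p.Prime).ne_zero
  obtain ⟨e, he⟩ := Ideal.mem_span_singleton.mp (PadicInt.appr_spec k z)
  have he' : (p : ℚ_[p]) ^ k * x - (z.appr k : ℚ_[p]) = (p : ℚ_[p]) ^ k * e := by
    have := congrArg (fun t : ℤ_[p] => (t : ℚ_[p])) he
    rw [PadicInt.coe_sub] at this
    simpa [hz] using this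
  have : x - (fractPart x : ℚ_[p]) = e := by
    have h1 : (fractPart x : ℚ_[p]) = (z.appr k : ℚ_[p]) / (p : ℚ_[p]) ^ k := by
      simp only [fractPart]; push_cast; rfl
    rw [h1]
    field_simp
    linear_combination he'
  rw [this]
  exact e.2

theorem chi_eq_of_close (x : ℚ_[p]) (m : ℤ) (k : ℕ)
    (h : ‖x - (((m : ℚ) / (p : ℚ) ^ k : ℚ) : ℚ_[p])‖ ≤ 1) :
    chi x = Complex.exp (2 * Real.pi * Complex.I * (((m : ℚ) / (p : ℚ) ^ k : ℚ) : ℂ)) := by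
  obtain ⟨⟨m', k', hf⟩, hc⟩ := fractPart_spec x
  have hp0 : (p : ℚ) ≠ 0 := by exact_mod_cast (Fact.out : p.Prime).ne_zero
  have hp0' : (p : ℚ_[p]) ≠ 0 := by exact_mod_cast (Fact.out : p.Prime).ne_zero
  have hpR : (p : ℝ) ≠ 0 := by exact_mod_cast (Fact.out : p.Prime).ne_zero
  set q : ℚ := (m : ℚ) / (p : ℚ) ^ k with hq
  have hd : ‖((fractPart x - q : ℚ) : ℚ_[p])‖ ≤ 1 := by
    have : ((fractPart x - q : ℚ) : ℚ_[p]) = (x - (q : ℚ_[p])) - (x - (fractPart x : ℚ_[p])) := by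
      push_cast; ring
    rw [this]
    rw [sub_eq_add_neg]
    exact (Padic.nonarchimedean _ _).trans (max_le h (by rwa [norm_neg]))
  set N : ℤ := m' * p ^ k - m * p ^ k' with hN
  have hdiff : fractPart x - q = (N : ℚ) / (p : ℚ) ^ (k + k') := by
    rw [hf, hq, hN]; push_cast; field_simp; ring
  have hdvd : ((p : ℤ) ^ (k + k')) ∣ N := by
    have h2 : ‖(N : ℚ_[p])‖ ≤ (p : ℝ) ^ (-((k + k' : ℕ) : ℤ)) := by
      have h3 : (N : ℚ_[p]) = ((fractPart x - q : ℚ) : ℚ_[p]) * (p : ℚ_[p]) ^ (k + k') := by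
        rw [hdiff]; push_cast; field_simp
      rw [h3, norm_mul, norm_pow, Padic.norm_p, inv_pow, zpow_neg, zpow_natCast]
      exact mul_le_of_le_one_left (by positivity) hd
    have := (Padic.norm_int_le_pow_iff_dvd N (k + k')).mp h2
    exact_mod_cast this
  obtain ⟨c, hc'⟩ := hdvd
  have hfin : fractPart x = q + c := by
    have : fractPart x - q = c := by
      rw [hdiff, hc']; push_cast; field_simp
    linarith
  rw [chi, hfin]
  push_cast
  rw [mul_add, Complex.exp_add]
  have : Complex.exp (2 * Real.pi * Complex.I * (c : ℂ)) = 1 := by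
    rw [mul_comm]; exact Complex.exp_int_mul_two_pi_mul_I c
  rw [this, mul_one]

theorem chi_add (x y : ℚ_[p]) : chi (x + y) = chi x * chi y := by
  obtain ⟨⟨m, k, hf⟩, hc⟩ := fractPart_spec x
  obtain ⟨⟨m', k', hf'⟩, hc'⟩ := fractPart_spec y
  have hp0 : (p : ℚ) ≠ 0 := by exact_mod_cast (Fact.out : p.Prime).ne_zero
  have hs : fractPart x + fractPart y
      = ((m * p ^ k' + m' * p ^ k : ℤ) : ℚ) / (p : ℚ) ^ (k + k') := by
    rw [hf, hf']; push_cast; field_simp; ring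
  rw [chi_eq_of_close (x + y) (m * p ^ k' + m' * p ^ k) (k + k'), ← hs, chi, chi,
    ← Complex.exp_add]
  · congr 1; push_cast; ring
  · rw [← hs]
    have : x + y - ((fractPart x + fractPart y : ℚ) : ℚ_[p])
        = (x - (fractPart x : ℚ_[p])) + (y - (fractPart y : ℚ_[p])) := by push_cast; ring
    rw [this]
    exact (Padic.nonarchimedean _ _).trans (max_le hc hc')

theorem chi_eq_one {x : ℚ_[p]} (hx : ‖x‖ ≤ 1) : chi x = 1 := by
  rw [chi_eq_of_close x 0 0 (by simpa using hx)]; simp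

theorem chi_inv_p_ne_one : chi ((p : ℚ_[p])⁻¹) ≠ 1 := by
  rw [chi_eq_of_close _ 1 1 (by simp)]
  have hp : 1 < p := (Fact.out : p.Prime).one_lt
  have hp0 : (p : ℂ) ≠ 0 := by exact_mod_cast (Fact.out : p.Prime).ne_zero
  intro h
  obtain ⟨n, hn⟩ := Complex.exp_eq_one_iff.mp h
  have h2 : (2 * Real.pi * Complex.I : ℂ) ≠ 0 := Complex.two_pi_I_ne_zero
  have h3 : (1 : ℂ) = n * p := by
    have : (2 * Real.pi * Complex.I : ℂ) * 1 = (2 * Real.pi * Complex.I) * (n * p) := by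
      push_cast at hn
      field_simp at hn
      linear_combination (2 * Real.pi * Complex.I : ℂ) * hn
    exact mul_left_cancel₀ h2 this
  have h4 : (1 : ℤ) = n * p := by exact_mod_cast h3
  have h5 : (p : ℤ) ∣ 1 := ⟨n, by rw [h4]; ring⟩
  have := Int.le_of_dvd one_pos h5
  omega

theorem chi_norm (x : ℚ_[p]) : ‖chi x‖ = 1 := by
  rw [chi]
  have : (2 * Real.pi * Complex.I * ((fractPart x : ℚ) : ℂ))
      = ((2 * Real.pi * (fractPart x : ℚ) : ℝ) : ℂ) * Complex.I := by push_cast; ring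
  rw [this, Complex.norm_exp_ofReal_mul_I]

theorem chi_isLocallyConstant : IsLocallyConstant (chi : ℚ_[p] → ℂ) := by
  rw [IsLocallyConstant.iff_eventually_eq]
  intro x
  filter_upwards [closedBall_mem_nhds x one_pos] with y hy
  have h1 : ‖y - x‖ ≤ 1 := by simpa [dist_eq_norm] using hy
  have h2 := chi_add x (y - x)
  rwa [chi_eq_one h1, mul_one, add_sub_cancel] at h2

end Character

/-! ## Haar measure, test functions, Fourier transform on `ℚ_p^n` -/

section Space

instance instMeasurableSpacePadic (p : ℕ) [Fact p.Prime] : MeasurableSpace ℚ_[p] := borel _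

instance instBorelSpacePadic (p : ℕ) [Fact p.Prime] : BorelSpace ℚ_[p] := ⟨rfl⟩

variable (p : ℕ) [Fact p.Prime] (n : ℕ)

/-- The space `ℚ_p^n`; its norm is `‖x‖ = max_i |x_i|_p`. -/
abbrev Qn : Type := Fin n → ℚ_[p]

/-- The unit ball `ℤ_p^n` of `ℚ_p^n`. -/
def unitBall : TopologicalSpace.PositiveCompacts (Qn p n) where
  carrier := closedBall 0 1
  isCompact' := isCompact_closedBall 0 1
  interior_nonempty' :=
    ⟨0, mem_interior_iff_mem_nhds.mpr (closedBall_mem_nhds 0 one_pos)⟩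

/-- The Haar measure `d^n x` of `ℚ_p^n`, normalized so that `ℤ_p^n` has measure `1`. -/
def haar : Measure (Qn p n) := Measure.addHaarMeasure (unitBall p n)

instance instIsAddHaarMeasureHaar : (haar p n).IsAddHaarMeasure :=
  inferInstanceAs (Measure.addHaarMeasure (unitBall p n)).IsAddHaarMeasure

instance instSigmaFiniteHaar : SigmaFinite (haar p n) :=
  inferInstanceAs (SigmaFinite (Measure.addHaarMeasure (unitBall p n)))

/-- The Bruhat-Schwartz space `S(ℚ_p^n)`: locally constant functions with compact support. -/
def BruhatSchwartz : Submodule ℂ (Qn p n → ℂ) where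
  carrier := {φ | IsLocallyConstant φ ∧ HasCompactSupport φ}
  add_mem' := fun h h' => ⟨h.1.add h'.1, h.2.add h'.2⟩
  zero_mem' := ⟨IsLocallyConstant.const 0, HasCompactSupport.zero⟩
  smul_mem' := fun c _ h => ⟨h.1.comp (fun z => c • z), h.2.comp_left (smul_zero c)⟩

/-- The space `Ψ(ℚ_p^n)` of test functions vanishing at the origin. -/
def Psi : Submodule ℂ (Qn p n → ℂ) where
  carrier := {ψ | ψ ∈ BruhatSchwartz p n ∧ ψ 0 = 0}
  add_mem' := fun h h' => ⟨add_mem h.1 h'.1, by simp [h.2, h'.2]⟩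
  zero_mem' := ⟨zero_mem _, rfl⟩
  smul_mem' := fun c _ h => ⟨Submodule.smul_mem _ c h.1, by simp [h.2]⟩

variable {p n}

/-- The Fourier transform `(F φ)(ξ) = ∫ χ(-ξ·x) φ(x) d^n x`. -/
def fourier (φ : Qn p n → ℂ) (ξ : Qn p n) : ℂ :=
  ∫ x, chi (-(ξ ⬝ᵥ x)) * φ x ∂(haar p n)

/-- The inverse Fourier transform `(F⁻¹ g)(x) = ∫ χ(ξ·x) g(ξ) d^n ξ`. -/
def fourierInv (g : Qn p n → ℂ) (x : Qn p n) : ℂ :=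
  ∫ ξ, chi (ξ ⬝ᵥ x) * g ξ ∂(haar p n)

theorem continuous_chi_dot (ξ : Qn p n) : Continuous fun x : Qn p n => chi (-(ξ ⬝ᵥ x)) := by
  refine chi_isLocallyConstant.continuous.comp ?_
  simp only [dotProduct]
  fun_prop

theorem integrable_chi_mul {φ : Qn p n → ℂ} (h : φ ∈ BruhatSchwartz p n) (ξ : Qn p n) :
    Integrable (fun x => chi (-(ξ ⬝ᵥ x)) * φ x) (haar p n) :=
  ((continuous_chi_dot ξ).mul h.1.continuous).integrable_of_hasCompactSupport h.2.mul_left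

theorem norm_dot_le {x y : Qn p n} {r s : ℝ} (hr : 0 ≤ r) (hx : ‖x‖ ≤ r) (hy : ‖y‖ ≤ s) :
    ‖x ⬝ᵥ y‖ ≤ r * s := by
  have hs : 0 ≤ s := (norm_nonneg _).trans hy
  rw [dotProduct]
  refine IsUltrametricDist.norm_sum_le_of_forall_le_of_nonneg (by positivity) fun i _ => ?_
  rw [norm_mul]
  exact mul_le_mul ((norm_le_pi_norm x i).trans hx) ((norm_le_pi_norm y i).trans hy)
    (norm_nonneg _) hr

theorem exists_chi_ne_one {ξ : Qn p n} {C : ℝ} (hC : 0 < C) (h : C < ‖ξ‖) :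
    ∃ t : Qn p n, ‖t‖ ≤ p / C ∧ chi (-(ξ ⬝ᵥ t)) ≠ 1 := by
  have : ¬ ∀ i, ‖ξ i‖ ≤ C := fun h' => absurd ((pi_norm_le_iff_of_nonneg hC.le).mpr h') h.not_ge
  push Not at this
  obtain ⟨i, hi⟩ := this
  have hp0 : (p : ℚ_[p]) ≠ 0 := by exact_mod_cast (Fact.out : p.Prime).ne_zero
  have hξ : ξ i ≠ 0 := norm_pos_iff.mp (hC.trans hi)
  refine ⟨Pi.single i (-((p : ℚ_[p]) * ξ i)⁻¹), ?_, ?_⟩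
  · rw [Pi.norm_single, norm_neg, norm_inv, norm_mul, Padic.norm_p, mul_inv, inv_inv,
      div_eq_mul_inv]
    gcongr
  · rw [dotProduct_single]
    have : -(ξ i * -((p : ℚ_[p]) * ξ i)⁻¹) = (p : ℚ_[p])⁻¹ := by field_simp
    rw [this]
    exact chi_inv_p_ne_one

theorem exists_invariant {φ : Qn p n → ℂ} (h : φ ∈ BruhatSchwartz p n) :
    ∃ r > 0, ∀ x t : Qn p n, ‖t‖ < r → φ (x + t) = φ x := by
  obtain ⟨δ, hδ, H⟩ := lebesgue_number_lemma_of_metric (s := tsupport φ)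
    (c := fun v : ℂ => φ ⁻¹' {v}) h.2 (fun v => h.1 {v})
    (fun x _ => Set.mem_iUnion.mpr ⟨φ x, rfl⟩)
  have key : ∀ x ∈ tsupport φ, ∀ t : Qn p n, ‖t‖ < δ → φ (x + t) = φ x := by
    intro x hx t ht
    obtain ⟨v, hv⟩ := H x hx
    have h1 : φ x = v := hv (mem_ball_self hδ)
    have h2 : φ (x + t) = v := hv (by simpa [mem_ball, dist_eq_norm] using ht)
    rw [h1, h2]
  refine ⟨δ, hδ, fun x t ht => ?_⟩
  by_cases hx : x ∈ tsupport φ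
  · exact key x hx t ht
  by_cases hy : x + t ∈ tsupport φ
  · have := key (x + t) hy (-t) (by rwa [norm_neg])
    rw [add_neg_cancel_right] at this
    exact this.symm
  · rw [image_eq_zero_of_notMem_tsupport hx, image_eq_zero_of_notMem_tsupport hy]

theorem exists_support_bound {φ : Qn p n → ℂ} (h : φ ∈ BruhatSchwartz p n) :
    ∃ R > 0, ∀ x : Qn p n, R < ‖x‖ → φ x = 0 := by
  obtain ⟨R, hR, H⟩ := h.2.isBounded.exists_pos_norm_le
  refine ⟨R, hR, fun x hx => ?_⟩
  by_contra hne
  exact absurd (H x (subset_tsupport _ hne)) hx.not_ge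

theorem fourier_mem {φ : Qn p n → ℂ} (h : φ ∈ BruhatSchwartz p n) :
    fourier φ ∈ BruhatSchwartz p n := by
  obtain ⟨r, hr, hinv⟩ := exists_invariant h
  obtain ⟨R, hR, hsupp⟩ := exists_support_bound h
  have hp0 : (0 : ℝ) < p := by exact_mod_cast (Fact.out : p.Prime).pos
  constructor
  · rw [IsLocallyConstant.iff_eventually_eq]
    intro ξ
    filter_upwards [closedBall_mem_nhds ξ (inv_pos.mpr hR)] with η hη
    unfold fourier
    congr 1
    funext x
    by_cases hx : R < ‖x‖
    · simp [hsupp x hx]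
    · have h1 : ‖-((η - ξ) ⬝ᵥ x)‖ ≤ 1 := by
        rw [norm_neg]
        refine (norm_dot_le (inv_nonneg.mpr hR.le) ?_ (not_lt.mp hx)).trans
          (inv_mul_cancel₀ hR.ne').le
        simpa [mem_closedBall, dist_eq_norm] using hη
      have h2 := chi_add (-(ξ ⬝ᵥ x)) (-((η - ξ) ⬝ᵥ x))
      rw [chi_eq_one h1, mul_one, ← neg_add, ← add_dotProduct, add_sub_cancel] at h2
      rw [h2]
  · refine HasCompactSupport.intro (isCompact_closedBall (0 : Qn p n) (2 * p / r)) ?_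
    intro ξ hξ
    have hξ' : 2 * p / r < ‖ξ‖ := by simpa [mem_closedBall] using hξ
    obtain ⟨t, ht, hne⟩ := exists_chi_ne_one (by positivity) hξ'
    have ht' : ‖t‖ < r := by
      refine ht.trans_lt ?_
      have : (p : ℝ) / (2 * p / r) = r / 2 := by field_simp
      rw [this]; linarith
    have e1 : fourier φ ξ = chi (-(ξ ⬝ᵥ t)) * fourier φ ξ := by
      conv_lhs => rw [fourier, ← integral_add_right_eq_self _ t]
      rw [fourier, ← integral_const_mul]
      congr 1
      funext x
      rw [hinv x t ht', dotProduct_add, neg_add, chi_add]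
      ring
    have e2 : (1 - chi (-(ξ ⬝ᵥ t))) * fourier φ ξ = 0 := by linear_combination e1
    rcases mul_eq_zero.mp e2 with e3 | e3
    · exact absurd (sub_eq_zero.mp e3).symm hne
    · exact e3

theorem integral_chi_ball (N : ℝ) (z : Qn p n) (h : ∃ t : Qn p n, ‖t‖ ≤ N ∧ chi (-(z ⬝ᵥ t)) ≠ 1) :
    ∫ ξ in closedBall (0 : Qn p n) N, chi (-(z ⬝ᵥ ξ)) ∂(haar p n) = 0 := by
  obtain ⟨t, ht, hne⟩ := h
  set I := ∫ ξ in closedBall (0 : Qn p n) N, chi (-(z ⬝ᵥ ξ)) ∂(haar p n) with hI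
  have e1 : I = chi (-(z ⬝ᵥ t)) * I := by
    conv_lhs => rw [hI, ← integral_indicator measurableSet_closedBall,
      ← integral_add_right_eq_self _ t]
    rw [hI, ← integral_indicator measurableSet_closedBall, ← integral_const_mul]
    congr 1
    funext x
    have hiff : x + t ∈ closedBall (0 : Qn p n) N ↔ x ∈ closedBall (0 : Qn p n) N := by
      simp only [mem_closedBall_zero_iff]
      constructor
      · intro hx
        have : x = (x + t) + -t := by ring
        rw [this]
        exact (IsUltrametricDist.norm_add_le_max _ _).trans (max_le hx (by rwa [norm_neg]))
      · intro hx
        exact (IsUltrametricDist.norm_add_le_max _ _).trans (max_le hx ht)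
    by_cases hx : x ∈ closedBall (0 : Qn p n) N
    · rw [Set.indicator_of_mem (hiff.mpr hx), Set.indicator_of_mem hx, dotProduct_add, neg_add,
        chi_add]
      ring
    · rw [Set.indicator_of_notMem (fun h => hx (hiff.mp h)), Set.indicator_of_notMem hx, mul_zero]
  have e2 : (1 - chi (-(z ⬝ᵥ t))) * I = 0 := by linear_combination e1
  rcases mul_eq_zero.mp e2 with e3 | e3
  · exact absurd (sub_eq_zero.mp e3).symm hne
  · exact e3

/-- The Fourier transform is injective on test functions. -/
theorem eq_zero_of_fourier_eq_zero {ψ : Qn p n → ℂ} (h : ψ ∈ BruhatSchwartz p n)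
    (h0 : fourier ψ = 0) : ψ = 0 := by
  obtain ⟨r, hr, hinv⟩ := exists_invariant h
  have hp1 : (1 : ℝ) < p := by exact_mod_cast (Fact.out : p.Prime).one_lt
  obtain ⟨k, hk⟩ := exists_pow_lt_of_lt_one hr (inv_lt_one_of_one_lt₀ hp1)
  set N : ℝ := (p : ℝ) ^ k with hN
  have hNpos : 0 < N := by positivity
  have hNr : N⁻¹ < r := by rwa [hN, ← inv_pow]
  funext y
  set B := closedBall (0 : Qn p n) N with hB
  have : IsFiniteMeasure ((haar p n).restrict B) :=
    ⟨by rw [Measure.restrict_apply_univ]; exact (isCompact_closedBall _ _).measure_lt_top⟩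
  have hsw : ∫ ξ in B, (∫ x, chi (ξ ⬝ᵥ y) * (chi (-(ξ ⬝ᵥ x)) * ψ x) ∂(haar p n)) ∂(haar p n)
      = ∫ x, (∫ ξ in B, chi (ξ ⬝ᵥ y) * (chi (-(ξ ⬝ᵥ x)) * ψ x) ∂(haar p n)) ∂(haar p n) := by
    apply integral_integral_swap
    have hψ : Integrable ψ (haar p n) := h.1.continuous.integrable_of_hasCompactSupport h.2
    have h1 : Integrable (fun _ : Qn p n => (1 : ℂ)) ((haar p n).restrict B) := integrable_const 1
    refine (h1.mul_prod hψ).mono ?_ ?_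
    · refine Continuous.aestronglyMeasurable ?_
      have hc : Continuous (chi : ℚ_[p] → ℂ) := chi_isLocallyConstant.continuous
      have hψc := h.1.continuous
      simp only [Function.uncurry_def, dotProduct]
      fun_prop
    · refine Eventually.of_forall fun z => ?_
      simp [Function.uncurry_def, chi_norm]
  have hL : ∫ ξ in B, (∫ x, chi (ξ ⬝ᵥ y) * (chi (-(ξ ⬝ᵥ x)) * ψ x) ∂(haar p n)) ∂(haar p n) = 0 := by
    have : ∀ ξ, ∫ x, chi (ξ ⬝ᵥ y) * (chi (-(ξ ⬝ᵥ x)) * ψ x) ∂(haar p n) = 0 := by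
      intro ξ
      rw [integral_const_mul]
      have : ∫ x, chi (-(ξ ⬝ᵥ x)) * ψ x ∂(haar p n) = 0 := congrFun h0 ξ
      rw [this, mul_zero]
    simp [this]
  have hR : ∀ x, ∫ ξ in B, chi (ξ ⬝ᵥ y) * (chi (-(ξ ⬝ᵥ x)) * ψ x) ∂(haar p n)
      = (closedBall y N⁻¹).indicator (fun _ => ((haar p n).real B : ℂ) * ψ y) x := by
    intro x
    have e1 : ∀ ξ : Qn p n, chi (ξ ⬝ᵥ y) * (chi (-(ξ ⬝ᵥ x)) * ψ x)
        = chi (-((x - y) ⬝ᵥ ξ)) * ψ x := by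
      intro ξ
      rw [← mul_assoc, ← chi_add]
      congr 2
      rw [dotProduct_comm (x - y), dotProduct_sub]
      ring
    simp only [e1]
    rw [integral_mul_const]
    by_cases hx : x ∈ closedBall y N⁻¹
    · rw [Set.indicator_of_mem hx]
      have hx' : ‖x - y‖ ≤ N⁻¹ := by simpa [mem_closedBall, dist_eq_norm] using hx
      have e2 : ψ x = ψ y := by
        have := hinv y (x - y) (hx'.trans_lt hNr)
        rwa [add_sub_cancel] at this
      rw [e2]
      congr 1
      have e3 : ∫ ξ in B, chi (-((x - y) ⬝ᵥ ξ)) ∂(haar p n) = ∫ _ξ in B, (1 : ℂ) ∂(haar p n) := by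
        refine setIntegral_congr_fun measurableSet_closedBall fun ξ hξ => ?_
        refine chi_eq_one ?_
        rw [norm_neg]
        refine (norm_dot_le (inv_nonneg.mpr hNpos.le) hx' (mem_closedBall_zero_iff.mp hξ)).trans
          (inv_mul_cancel₀ hNpos.ne').le
      rw [e3]
      simp
    · rw [Set.indicator_of_notMem hx]
      have hx' : N⁻¹ < ‖x - y‖ := by simpa [mem_closedBall, dist_eq_norm] using hx
      rw [integral_chi_ball, zero_mul]
      have : ¬ ∀ i, ‖(x - y) i‖ ≤ N⁻¹ := fun h' =>
        absurd ((pi_norm_le_iff_of_nonneg (inv_nonneg.mpr hNpos.le)).mpr h') hx'.not_ge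
      push Not at this
      obtain ⟨i, hi⟩ := this
      have hi2 : (p : ℝ) * N⁻¹ ≤ ‖(x - y) i‖ := by
        by_contra hlt
        push Not at hlt
        have e4 : ‖(x - y) i‖ ≤ (p : ℝ) ^ (-(k : ℤ)) := by
          rw [Padic.norm_le_pow_iff_norm_lt_pow_add_one, zpow_add₀ (by positivity), zpow_neg,
            zpow_natCast, zpow_one, mul_comm]
          exact hlt
        rw [zpow_neg, zpow_natCast] at e4
        exact absurd e4 hi.not_ge
      have hp0 : (p : ℚ_[p]) ≠ 0 := by exact_mod_cast (Fact.out : p.Prime).ne_zero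
      have hpos : 0 < ‖(x - y) i‖ := (inv_pos.mpr hNpos).trans hi
      have hz : (x - y) i ≠ 0 := norm_pos_iff.mp hpos
      refine ⟨Pi.single i (-((p : ℚ_[p]) * (x - y) i)⁻¹), ?_, ?_⟩
      · rw [Pi.norm_single, norm_neg, norm_inv, norm_mul, Padic.norm_p, mul_inv, inv_inv,
          ← div_eq_mul_inv, div_le_iff₀ hpos]
        rw [← div_eq_mul_inv, div_le_iff₀ hNpos] at hi2
        linarith
      · rw [dotProduct_single]
        have : -((x - y) i * -((p : ℚ_[p]) * (x - y) i)⁻¹) = (p : ℚ_[p])⁻¹ := by field_simp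
        rw [this]
        exact chi_inv_p_ne_one
  rw [hL] at hsw
  simp only [hR] at hsw
  rw [integral_indicator measurableSet_closedBall] at hsw
  have hpos : ∀ (c : Qn p n) (s : ℝ), 0 < s → (haar p n).real (closedBall c s) ≠ 0 := by
    intro c s hs
    refine (ENNReal.toReal_pos ?_ ?_).ne'
    · exact (measure_closedBall_pos _ _ hs).ne'
    · exact (isCompact_closedBall _ _).measure_lt_top.ne
  have h1 := hpos 0 N hNpos
  have h2 := hpos y N⁻¹ (inv_pos.mpr hNpos)
  simp only [integral_const, MeasureTheory.measureReal_restrict_apply_univ] at hsw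
  simpa [h1, h2, hB] using hsw

end Space

/-! ## Lizorkin spaces of the second kind -/

section Lizorkin

variable (p : ℕ) [Fact p.Prime] (n : ℕ)

/-- The Fourier transform as a linear map on `Ψ(ℚ_p^n)`. -/
def fourierOnPsi : Psi p n →ₗ[ℂ] (Qn p n → ℂ) where
  toFun ψ := fourier ψ.1
  map_add' ψ ψ' := by
    funext ξ
    change ∫ x, chi (-(ξ ⬝ᵥ x)) * (ψ.1 x + ψ'.1 x) ∂(haar p n) = _
    simp only [mul_add]
    exact integral_add (integrable_chi_mul ψ.2.1 ξ) (integrable_chi_mul ψ'.2.1 ξ)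
  map_smul' c ψ := by
    funext ξ
    change ∫ x, chi (-(ξ ⬝ᵥ x)) * (c * ψ.1 x) ∂(haar p n) = c * _
    rw [fourier, ← integral_const_mul]
    congr 1
    funext x
    ring

/-- The Lizorkin space `Φ(ℚ_p^n) = F[Ψ(ℚ_p^n)]` of test functions of the second kind. -/
def Phi : Submodule ℂ (Qn p n → ℂ) := LinearMap.range (fourierOnPsi p n)

/-- The space `Φ'(ℚ_p^n)` of Lizorkin distributions of the second kind. Every linear functional on
the Bruhat-Schwartz space is continuous, and hence so is every linear functional on its subspace
`Φ`: the topological dual is the algebraic dual. -/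
abbrev PhiDual : Type := Module.Dual ℂ (Phi p n)

/-- The space `Ψ'(ℚ_p^n)`, the dual of `Ψ(ℚ_p^n)`. -/
abbrev PsiDual : Type := Module.Dual ℂ (Psi p n)

theorem fourierOnPsi_injective : Function.Injective (fourierOnPsi p n) := by
  rw [injective_iff_map_eq_zero]
  intro ψ h
  exact Subtype.ext (eq_zero_of_fourier_eq_zero ψ.2.1 h)

/-- The Fourier transform as a linear isomorphism `Ψ ≃ Φ`. -/
def fourierPsiPhi : Psi p n ≃ₗ[ℂ] Phi p n :=
  LinearEquiv.ofInjective (fourierOnPsi p n) (fourierOnPsi_injective p n)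

/-- The Fourier transform of Lizorkin distributions, `⟨F[J], ψ⟩ = ⟨J, F[ψ]⟩` for `J ∈ Φ'` and
`ψ ∈ Ψ`, as a linear isomorphism `Φ' ≃ Ψ'`. -/
def fourierDual : PhiDual p n ≃ₗ[ℂ] PsiDual p n := (fourierPsiPhi p n).dualMap

variable {p n}

theorem fourierDual_apply (J : PhiDual p n) (ψ : Psi p n) :
    fourierDual p n J ψ = J ⟨fourier ψ.1, ψ, rfl⟩ := rfl

theorem phi_mem_bruhatSchwartz {φ : Qn p n → ℂ} (h : φ ∈ Phi p n) : φ ∈ BruhatSchwartz p n := by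
  obtain ⟨ψ, rfl⟩ := h
  exact fourier_mem ψ.2.1

theorem phi_reflect_translate_mem {φ : Qn p n → ℂ} (h : φ ∈ Phi p n) (x : Qn p n) :
    (fun y => φ (x - y)) ∈ Phi p n := by
  obtain ⟨ψ, rfl⟩ := h
  have hψ := ψ.2
  refine ⟨⟨fun w => chi (x ⬝ᵥ w) * ψ.1 (-w), ⟨?_, ?_⟩, ?_⟩, ?_⟩
  · have h1 : IsLocallyConstant fun w : Qn p n => chi (x ⬝ᵥ w) := by
      refine chi_isLocallyConstant.comp_continuous (f := fun w : Qn p n => x ⬝ᵥ w) ?_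
      simp only [dotProduct]
      fun_prop
    have h2 : IsLocallyConstant fun w : Qn p n => ψ.1 (-w) :=
      hψ.1.1.comp_continuous (f := fun w : Qn p n => -w) continuous_neg
    exact h1.mul h2
  · exact (hψ.1.2.comp_homeomorph (Homeomorph.neg (Qn p n))).mul_left
  · simp [hψ.2]
  · funext y
    change ∫ w, chi (-(y ⬝ᵥ w)) * (chi (x ⬝ᵥ w) * ψ.1 (-w)) ∂(haar p n)
      = ∫ w, chi (-((x - y) ⬝ᵥ w)) * ψ.1 w ∂(haar p n)
    rw [← integral_neg_eq_self (fun w => chi (-((x - y) ⬝ᵥ w)) * ψ.1 w) (haar p n)]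
    congr 1
    funext w
    rw [← mul_assoc, ← chi_add]
    congr 2
    rw [dotProduct_neg, sub_dotProduct]
    ring

/-- The convolution `(E ∗ φ)(x) = ⟨E(y), φ(x - y)⟩` of `E ∈ Φ'` and `φ ∈ Φ`. -/
def conv (E : PhiDual p n) (φ : Phi p n) (x : Qn p n) : ℂ :=
  E ⟨fun y => φ.1 (x - y), phi_reflect_translate_mem φ.2 x⟩

theorem integrable_mul_phi {g : Qn p n → ℂ} (hg : LocallyIntegrable g (haar p n))
    {φ : Qn p n → ℂ} (h : φ ∈ Phi p n) : Integrable (fun x => g x * φ x) (haar p n) := by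
  have hφ := phi_mem_bruhatSchwartz h
  have := hg.integrable_smul_left_of_hasCompactSupport hφ.1.continuous hφ.2
  simpa [mul_comm] using this

/-- The Lizorkin distribution `φ ↦ ∫ g(x) φ(x) d^n x` induced by a locally integrable function. -/
def distOf (g : Qn p n → ℂ) (hg : LocallyIntegrable g (haar p n)) : PhiDual p n where
  toFun φ := ∫ x, g x * φ.1 x ∂(haar p n)
  map_add' φ φ' := by
    change ∫ x, g x * (φ.1 x + φ'.1 x) ∂(haar p n) = _
    simp only [mul_add]
    exact integral_add (integrable_mul_phi hg φ.2) (integrable_mul_phi hg φ'.2)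
  map_smul' c φ := by
    change ∫ x, g x * (c * φ.1 x) ∂(haar p n) = c * _
    rw [← integral_const_mul]
    congr 1
    funext x
    ring

end Lizorkin

/-! ## The quadratic forms and the pseudodifferential operators -/

section Operators

variable (p : ℕ) [Fact p.Prime] (a : ℤ)

/-- The quadratic form `f(x) = x₁² - a x₂² - p x₃² + a p x₄²` on `ℚ_p^4`. -/
def form (x : Qn p 4) : ℚ_[p] :=
  x 0 ^ 2 - a * x 1 ^ 2 - p * x 2 ^ 2 + a * p * x 3 ^ 2

/-- The quadratic form `f°(ξ) = a p ξ₁² - p ξ₂² - a ξ₃² + ξ₄²` on `ℚ_p^4`. -/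
def formCirc (ξ : Qn p 4) : ℚ_[p] :=
  a * p * ξ 0 ^ 2 - p * ξ 1 ^ 2 - a * ξ 2 ^ 2 + ξ 3 ^ 2

variable {p a}

theorem norm_sq_sub_mul_sq (ha : ¬ IsSquare (a : ZMod p)) (u v : ℚ_[p]) :
    ‖u ^ 2 - a * v ^ 2‖ = max ‖u‖ ‖v‖ ^ 2 := by
  have ha1 : ‖(a : ℚ_[p])‖ = 1 := by
    refine le_antisymm (Padic.norm_int_le_one a) (not_lt.mp fun h => ha ?_)
    rw [← PadicInt.coe_intCast, ← PadicInt.norm_def, PadicInt.norm_int_lt_one_iff_dvd] at h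
    rw [(ZMod.intCast_zmod_eq_zero_iff_dvd a p).mpr h]
    exact IsSquare.zero
  have hmax : max ‖u‖ ‖v‖ ^ 2 = max (‖u ^ 2‖) (‖(a : ℚ_[p]) * v ^ 2‖) := by
    rw [norm_mul, ha1, one_mul, norm_pow, norm_pow]
    rcases le_total ‖u‖ ‖v‖ with h | h
    · rw [max_eq_right h, max_eq_right (by gcongr)]
    · rw [max_eq_left h, max_eq_left (by gcongr)]
  by_cases huv : ‖u‖ = ‖v‖
  · rcases eq_or_ne v 0 with rfl | hv
    · have : u = 0 := by simpa using huv
      simp [this]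
    · have hv' : ‖v‖ ≠ 0 := norm_ne_zero_iff.mpr hv
      have hw : ‖u / v‖ = 1 := by rw [norm_div, huv, div_self hv']
      set w : ℤ_[p] := ⟨u / v, hw.le⟩ with hwdef
      have hone : ‖w ^ 2 - (a : ℤ_[p])‖ = 1 := by
        refine le_antisymm (PadicInt.norm_le_one _) (not_lt.mp fun h => ha ?_)
        have hmem : w ^ 2 - (a : ℤ_[p]) ∈ RingHom.ker (PadicInt.toZMod (p := p)) := by
          rw [PadicInt.ker_toZMod]
          exact PadicInt.mem_nonunits.mpr h
        rw [RingHom.mem_ker, map_sub, map_pow, map_intCast, sub_eq_zero] at hmem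
        exact ⟨PadicInt.toZMod w, by rw [← hmem, sq]⟩
      have hq : u ^ 2 - a * v ^ 2 = ((w ^ 2 - (a : ℤ_[p]) : ℤ_[p]) : ℚ_[p]) * v ^ 2 := by
        rw [PadicInt.coe_sub, PadicInt.coe_pow, PadicInt.coe_intCast]
        simp only [hwdef]
        field_simp
      rw [hq, norm_mul, norm_pow, huv, max_self]
      rw [← PadicInt.norm_def, hone, one_mul]
  · rw [hmax, sub_eq_add_neg, ← norm_neg ((a : ℚ_[p]) * v ^ 2)]
    refine Padic.add_eq_max_of_ne ?_
    rw [norm_neg, norm_mul, ha1, one_mul, norm_pow, norm_pow]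
    intro h
    exact huv ((pow_left_inj₀ (norm_nonneg _) (norm_nonneg _) two_ne_zero).mp h)

/-- The form `f°` is elliptic. -/
theorem eq_zero_of_formCirc_eq_zero (ha : ¬ IsSquare (a : ZMod p)) {ξ : Qn p 4}
    (h : formCirc p a ξ = 0) : ξ = 0 := by
  have h1 : (p : ℚ_[p]) * (ξ 1 ^ 2 - a * ξ 0 ^ 2) = ξ 3 ^ 2 - a * ξ 2 ^ 2 := by
    rw [formCirc] at h
    linear_combination -h
  have h2 := congrArg norm h1
  rw [norm_mul, norm_sq_sub_mul_sq ha, norm_sq_sub_mul_sq ha, Padic.norm_p] at h2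
  have hp1 : (1 : ℝ) < p := by exact_mod_cast (Fact.out : p.Prime).one_lt
  have hp0 : (0 : ℝ) < p := by linarith
  have key : ∀ u v : ℚ_[p], (p : ℝ)⁻¹ * ‖u‖ ^ 2 = ‖v‖ ^ 2 → u = 0 ∧ v = 0 := by
    intro u v huv
    by_cases hu : u = 0
    · refine ⟨hu, ?_⟩
      rw [hu] at huv
      simpa using huv.symm
    · exfalso
      have hv : v ≠ 0 := by
        rintro rfl
        have : ‖u‖ ≠ 0 := norm_ne_zero_iff.mpr hu
        simp [this, hp0.ne'] at huv
      rw [Padic.norm_eq_zpow_neg_valuation hu, Padic.norm_eq_zpow_neg_valuation hv,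
        ← zpow_natCast, ← zpow_natCast, ← zpow_mul, ← zpow_mul, ← zpow_neg_one,
        ← zpow_add₀ hp0.ne'] at huv
      have := zpow_right_injective₀ hp0 hp1.ne' huv
      push_cast at this
      omega
  have hex : ∀ u v : ℚ_[p], ∃ w : ℚ_[p], max ‖u‖ ‖v‖ = ‖w‖ := by
    intro u v
    rcases max_choice ‖u‖ ‖v‖ with h | h
    · exact ⟨u, h⟩
    · exact ⟨v, h⟩
  obtain ⟨w, hw⟩ := hex (ξ 1) (ξ 0)
  obtain ⟨w', hw'⟩ := hex (ξ 3) (ξ 2)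
  rw [hw, hw'] at h2
  obtain ⟨rfl, rfl⟩ := key w w' h2
  rw [norm_zero] at hw hw'
  have e1 : ξ 1 = 0 := norm_le_zero_iff.mp ((le_max_left _ _).trans hw.le)
  have e0 : ξ 0 = 0 := norm_le_zero_iff.mp ((le_max_right _ _).trans hw.le)
  have e3 : ξ 3 = 0 := norm_le_zero_iff.mp ((le_max_left _ _).trans hw'.le)
  have e2 : ξ 2 = 0 := norm_le_zero_iff.mp ((le_max_right _ _).trans hw'.le)
  funext i
  fin_cases i
  · exact e0
  · exact e1
  · exact e2
  · exact e3

variable (p a)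

/-- The symbol `|f°(ξ)|_p^α`. -/
def symbol (α : ℝ) (ξ : Qn p 4) : ℂ := ((‖formCirc p a ξ‖ ^ α : ℝ) : ℂ)

variable {p a}

theorem symbol_mul_mem (ha : ¬ IsSquare (a : ZMod p)) (α : ℝ) {ψ : Qn p 4 → ℂ}
    (h : ψ ∈ Psi p 4) : (fun ξ => symbol p a α ξ * ψ ξ) ∈ Psi p 4 := by
  refine ⟨⟨?_, h.1.2.mul_left⟩, by simp [h.2]⟩
  rw [IsLocallyConstant.iff_eventually_eq]
  intro ξ
  have hψ := (IsLocallyConstant.iff_eventually_eq ψ).mp h.1.1 ξ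
  by_cases hξ : ξ = 0
  · filter_upwards [hψ] with η hη
    rw [hη, hξ, h.2, mul_zero, mul_zero]
  · have hf : formCirc p a ξ ≠ 0 := fun h0 => hξ (eq_zero_of_formCirc_eq_zero ha h0)
    have hc : Continuous (formCirc p a) := by
      unfold formCirc
      fun_prop
    have hnear := hc.continuousAt.eventually (ball_mem_nhds (formCirc p a ξ) (norm_pos_iff.mpr hf))
    filter_upwards [hψ, hnear] with η hη hη'
    have hn : ‖formCirc p a η‖ = ‖formCirc p a ξ‖ := by
      rw [← norm_neg (formCirc p a ξ)]
      refine IsUltrametricDist.norm_eq_of_add_norm_lt_max ?_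
      rw [← sub_eq_add_neg, ← dist_eq_norm, norm_neg]
      exact lt_max_of_lt_right (mem_ball.mp hη')
    rw [hη, symbol, symbol, hn]

/-- Multiplication by `|f°|_p^α` on `Ψ(ℚ_p^4)`. -/
def mulSymbol (ha : ¬ IsSquare (a : ZMod p)) (α : ℝ) : Psi p 4 →ₗ[ℂ] Psi p 4 where
  toFun ψ := ⟨fun ξ => symbol p a α ξ * ψ.1 ξ, symbol_mul_mem ha α ψ.2⟩
  map_add' ψ ψ' := Subtype.ext (funext fun ξ => mul_add (symbol p a α ξ) (ψ.1 ξ) (ψ'.1 ξ))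
  map_smul' c ψ := Subtype.ext (funext fun ξ => mul_left_comm (symbol p a α ξ) c (ψ.1 ξ))

variable (p a) in
/-- The operator `f(∂, α) φ = F⁻¹(|f°|_p^α F φ)` on test functions. -/
def pseudoDiff (α : ℝ) (φ : Qn p 4 → ℂ) : Qn p 4 → ℂ :=
  fourierInv fun ξ => symbol p a α ξ * fourier φ ξ

/-- The operator `f(∂, α) J = F⁻¹[|f°|_p^α F[J]]` on `Φ'(ℚ_p^4)`, where multiplication by the symbol
on `Ψ'` is `⟨|f°|_p^α G, ψ⟩ = ⟨G, |f°|_p^α ψ⟩`. -/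
def pseudoDiffDual (ha : ¬ IsSquare (a : ZMod p)) (α : ℝ) : PhiDual p 4 →ₗ[ℂ] PhiDual p 4 :=
  (fourierDual p 4).symm.toLinearMap ∘ₗ (mulSymbol ha α).dualMap ∘ₗ (fourierDual p 4).toLinearMap

variable (p a)

/-- `u` is a classical solution of `f(∂, α) u = φ`: it belongs to the domain of the operator
`f(∂, α) : Φ → Φ` and satisfies the equation. -/
def IsClassicalSolution (α : ℝ) (φ : Phi p 4) (u : Qn p 4 → ℂ) : Prop :=
  u ∈ Phi p 4 ∧ pseudoDiff p a α u = φ.1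

/-- `E ∈ Φ'` is a fundamental solution of `f(∂, α) u = φ`: for every `φ ∈ Φ` the convolution
`E ∗ φ` is a classical solution. -/
def IsFundamentalSolution (α : ℝ) (E : PhiDual p 4) : Prop :=
  ∀ φ : Phi p 4, IsClassicalSolution p a α φ (conv E φ)

/-- The function `E_α`. -/
def fundSol (α : ℝ) (x : Qn p 4) : ℂ :=
  if α = 2 then
    ((-((1 - (p : ℝ) ^ (-2 : ℝ)) / Real.log p) * Real.log ‖form p a x‖ : ℝ) : ℂ)
  else
    (((1 - (p : ℝ) ^ (-α)) / (1 - (p : ℝ) ^ (α - 2)) * ‖form p a x‖ ^ (α - 2) : ℝ) : ℂ)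

/-- The family `s ↦ Z s ∈ Φ'(ℚ_p^4)` is the meromorphic continuation of the local zeta function
`⟨|f|_p^s, φ⟩ = ∫_{f(x) ≠ 0} |f(x)|_p^s φ(x) d^4 x`, `Re s > 0`, to the whole complex plane, with
poles at most at the points where `p^{s+2} = 1`. (Nothing is required of the value of `Z` at these
points.) -/
structure IsMeromorphicContinuation (Z : ℂ → PhiDual p 4) : Prop where
  eq_integral : ∀ s : ℂ, 0 < s.re → ∀ φ : Phi p 4,
    Z s φ = ∫ x in {x | form p a x ≠ 0}, ((‖form p a x‖ : ℝ) : ℂ) ^ s * φ.1 x ∂(haar p 4)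
  meromorphic : ∀ φ : Phi p 4, MeromorphicOn (fun s => Z s φ) Set.univ
  analyticAt : ∀ φ : Phi p 4, ∀ s : ℂ, (p : ℂ) ^ (s + 2) ≠ 1 → AnalyticAt ℂ (fun s => Z s φ) s

/-- The factor `(1 - p^{s+1})(1 - p^{-s-2}) / ((1 - p^{-s-3})(1 - p^s))`. -/
def bFactor (s : ℂ) : ℂ :=
  ((1 - (p : ℂ) ^ (s + 1)) * (1 - (p : ℂ) ^ (-s - 2))) /
    ((1 - (p : ℂ) ^ (-s - 3)) * (1 - (p : ℂ) ^ s))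

end Operators

end PadicRiesz

end

/-!
The forms `f` and `f°` are elliptic, and `|f|`, `|f°|` are squares of ultrametric norms
(`norm_form`, `formCirc_eq`). Hence the sublevel sets `{|f| ≤ p^{-m}}` and `{|f°| ≤ p^m}` are
lattices, and they are dual to each other (`chi_dot_eq_one`, `exists_chi_dot_ne_one`). The similarity
`(x₁, x₂, x₃, x₄) ↦ (p x₃, p x₄, x₁, x₂)` of `f` carries each lattice to the next one, and
`{|f| ≤ p^{-1}}` has index `p²` in `ℤ_p^4 = {|f| ≤ 1}`, so that `{|f| ≤ p^{-m}}` has volume `p^{-2m}`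
(`haar_real_lattice`). The Fourier transform of the indicator
function of a shell `{|f| = p^{-m}}` is therefore an explicit function of `|f°|`
(`integral_chi_shell`).

Let `g` be a locally integrable function of `|f|`. A function `ψ ∈ Ψ` meets only finitely many
shells of `f°`, so `∫ g · F ψ`, summed over the shells of `f`, equals `∫ κ · ψ`, where the value of
`κ` on a shell of `f°` is an explicit series (`integral_radial_mul_fourier`). For `g = |f|^s` the
series is geometric and gives the functional equation
`⟨|f|^s, F ψ⟩ = (1 - p^s) / (1 - p^{-s-2}) ⟨|f°|^{-s-2}, ψ⟩` for `Re s > -2`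
(`integral_cpow_norm_form_mul_fourier`); for `g = log |f|` it is the derivative of a geometric series.
In both cases the constants make `F E_α = |f°|^{-α}` (`integral_fundSol_mul_fourier`), whence
`E_α ∗ F ψ = F (|f°|^{-α} ψ)`, and Fourier inversion (`fourier_fourier`) shows that `E_α` is a
fundamental solution.

As `ψ` vanishes near the origin, `⟨|f°|^{-s-2}, ψ⟩` is a finite combination of powers of `p^{-s-2}`,
hence entire in `s`, and the functional equation defines the meromorphic continuation of `|f|^s`
(`isMeromorphicContinuation_formPower`). It is the only one, because `{s | p^{s+2} ≠ 1}` is connected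
(`IsMeromorphicContinuation.eq_of_cpow_ne_one`). The operator `f(∂, 1)` multiplies `|f°|^{-s-3}` by
`|f°|`, so both sides of the identity in `s` are multiples of `⟨|f°|^{-s-2}, ψ⟩`, with the same
coefficient.
-/

noncomputable section

namespace PadicRiesz

variable {p : ℕ} [Fact p.Prime] {a : ℤ}

/-! ### The norm of the forms -/

theorem one_lt_cast_prime : (1 : ℝ) < p := by exact_mod_cast (Fact.out : p.Prime).one_lt

theorem cast_prime_pos : (0 : ℝ) < p := by exact_mod_cast (Fact.out : p.Prime).pos

/-- An inequality `|u|² ≤ c` with `c < p²` already forces `|u| ≤ 1`, as the norm is discrete. -/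
theorem norm_le_one_of_sq_lt {u : ℚ_[p]} (h : ‖u‖ ^ 2 < (p : ℝ) ^ 2) : ‖u‖ ≤ 1 := by
  have h1 : ‖u‖ < p := lt_of_pow_lt_pow_left₀ 2 cast_prime_pos.le h
  have := (Padic.norm_le_pow_iff_norm_lt_pow_add_one u 0).mpr (by simpa using h1)
  simpa using this

/-- The two binary summands of `f` have norms of different parity. -/
theorem sq_norm_ne_inv_mul_sq_norm {u v : ℚ_[p]} (h : ‖v‖ ^ 2 = (p : ℝ)⁻¹ * ‖u‖ ^ 2) :
    u = 0 ∧ v = 0 := by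
  have hp1 := one_lt_cast_prime (p := p)
  have hp0 := cast_prime_pos (p := p)
  by_cases hu : u = 0
  · subst hu
    exact ⟨rfl, by simpa using h⟩
  · exfalso
    have hv : v ≠ 0 := by
      rintro rfl
      have : ‖u‖ ≠ 0 := norm_ne_zero_iff.mpr hu
      simp [this, hp0.ne'] at h
    rw [Padic.norm_eq_zpow_neg_valuation hu, Padic.norm_eq_zpow_neg_valuation hv,
      ← zpow_natCast, ← zpow_natCast, ← zpow_mul, ← zpow_mul, ← zpow_neg_one,
      ← zpow_add₀ hp0.ne'] at h
    have := zpow_right_injective₀ hp0 hp1.ne' h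
    push_cast at this
    omega

theorem norm_form (ha : ¬ IsSquare (a : ZMod p)) (x : Qn p 4) :
    ‖form p a x‖ = max (max ‖x 0‖ ‖x 1‖ ^ 2) ((p : ℝ)⁻¹ * max ‖x 2‖ ‖x 3‖ ^ 2) := by
  have e : form p a x = (x 0 ^ 2 - a * x 1 ^ 2) + -(p * (x 2 ^ 2 - a * x 3 ^ 2)) := by
    rw [form]; ring
  have e1 := norm_sq_sub_mul_sq ha (x 0) (x 1)
  have e2 : ‖-((p : ℚ_[p]) * (x 2 ^ 2 - a * x 3 ^ 2))‖ = (p : ℝ)⁻¹ * max ‖x 2‖ ‖x 3‖ ^ 2 := by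
    rw [norm_neg, norm_mul, norm_sq_sub_mul_sq ha, Padic.norm_p]
  have hex : ∀ u v : ℚ_[p], ∃ w : ℚ_[p], max ‖u‖ ‖v‖ = ‖w‖ := fun u v =>
    (max_choice ‖u‖ ‖v‖).elim (fun h => ⟨u, h⟩) fun h => ⟨v, h⟩
  by_cases h : max ‖x 0‖ ‖x 1‖ ^ 2 = (p : ℝ)⁻¹ * max ‖x 2‖ ‖x 3‖ ^ 2
  · obtain ⟨u, hu⟩ := hex (x 0) (x 1)
    obtain ⟨v, hv⟩ := hex (x 2) (x 3)
    rw [hu, hv] at h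
    obtain ⟨rfl, rfl⟩ := sq_norm_ne_inv_mul_sq_norm h
    rw [hu, norm_zero] at e1
    rw [hv, norm_zero] at e2
    have e1' : x 0 ^ 2 - a * x 1 ^ 2 = 0 := by rw [← norm_eq_zero, e1]; simp
    have e2' : -((p : ℚ_[p]) * (x 2 ^ 2 - a * x 3 ^ 2)) = 0 := by rw [← norm_eq_zero, e2]; simp
    rw [e, e1', e2', hu, hv]
    simp
  · rw [e, Padic.add_eq_max_of_ne, e1, e2]
    rwa [e1, e2]

/-- Reversal of the coordinates turns `f°` into `f`. -/
theorem formCirc_eq (ξ : Qn p 4) : formCirc p a ξ = form p a (fun i => ξ i.rev) := by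
  have h0 : (0 : Fin 4).rev = 3 := rfl
  have h1 : (1 : Fin 4).rev = 2 := rfl
  have h2 : (2 : Fin 4).rev = 1 := rfl
  have h3 : (3 : Fin 4).rev = 0 := rfl
  simp only [form, formCirc, h0, h1, h2, h3]
  ring

theorem norm_form_le_iff (ha : ¬ IsSquare (a : ZMod p)) (x : Qn p 4) {c : ℝ} :
    ‖form p a x‖ ≤ c ↔ (‖x 0‖ ^ 2 ≤ c ∧ ‖x 1‖ ^ 2 ≤ c) ∧
      (p : ℝ)⁻¹ * ‖x 2‖ ^ 2 ≤ c ∧ (p : ℝ)⁻¹ * ‖x 3‖ ^ 2 ≤ c := by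
  have hmax : ∀ s t : ℝ, 0 ≤ s → 0 ≤ t → max s t ^ 2 = max (s ^ 2) (t ^ 2) := by
    intro s t hs ht
    rcases le_total s t with h | h
    · rw [max_eq_right h, max_eq_right (by gcongr)]
    · rw [max_eq_left h, max_eq_left (by gcongr)]
  rw [norm_form ha, hmax _ _ (norm_nonneg _) (norm_nonneg _),
    hmax _ _ (norm_nonneg _) (norm_nonneg _),
    mul_max_of_nonneg _ _ (inv_nonneg.mpr cast_prime_pos.le), max_le_iff, max_le_iff, max_le_iff]

theorem form_eq_zero_iff (ha : ¬ IsSquare (a : ZMod p)) (x : Qn p 4) :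
    form p a x = 0 ↔ x = 0 := by
  constructor
  · intro h
    have h1 : formCirc p a (fun i => x i.rev) = 0 := by
      rw [formCirc_eq]; simpa using h
    have h2 := eq_zero_of_formCirc_eq_zero ha h1
    funext i
    simpa using congrFun h2 i.rev
  · rintro rfl
    simp [form]

theorem formCirc_eq_zero_iff (ha : ¬ IsSquare (a : ZMod p)) (ξ : Qn p 4) :
    formCirc p a ξ = 0 ↔ ξ = 0 :=
  ⟨eq_zero_of_formCirc_eq_zero ha, by rintro rfl; simp [formCirc]⟩

theorem form_neg (x : Qn p 4) : form p a (-x) = form p a x := by simp [form]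

theorem formCirc_neg (x : Qn p 4) : formCirc p a (-x) = formCirc p a x := by simp [formCirc]

theorem continuous_form : Continuous (form p a) := by unfold form; fun_prop

theorem continuous_formCirc : Continuous (formCirc p a) := by unfold formCirc; fun_prop

/-- `|f|` is the square of an ultrametric norm. -/
theorem norm_form_add_le (ha : ¬ IsSquare (a : ZMod p)) {x y : Qn p 4} {c : ℝ}
    (hx : ‖form p a x‖ ≤ c) (hy : ‖form p a y‖ ≤ c) : ‖form p a (x + y)‖ ≤ c := by
  rw [norm_form_le_iff ha] at *
  have key : ∀ u v : ℚ_[p], ‖u + v‖ ^ 2 ≤ ‖u‖ ^ 2 ∨ ‖u + v‖ ^ 2 ≤ ‖v‖ ^ 2 := by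
    intro u v
    rcases le_max_iff.mp (IsUltrametricDist.norm_add_le_max u v) with h | h
    · exact Or.inl (by gcongr)
    · exact Or.inr (by gcongr)
  have hp : (0 : ℝ) ≤ (p : ℝ)⁻¹ := inv_nonneg.mpr cast_prime_pos.le
  have k1 : ∀ u v : ℚ_[p], ‖u‖ ^ 2 ≤ c → ‖v‖ ^ 2 ≤ c → ‖u + v‖ ^ 2 ≤ c := fun u v hu hv =>
    (key u v).elim (fun h => h.trans hu) fun h => h.trans hv
  have k2 : ∀ u v : ℚ_[p], (p : ℝ)⁻¹ * ‖u‖ ^ 2 ≤ c → (p : ℝ)⁻¹ * ‖v‖ ^ 2 ≤ c →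
      (p : ℝ)⁻¹ * ‖u + v‖ ^ 2 ≤ c := fun u v hu hv =>
    (key u v).elim (fun h => (mul_le_mul_of_nonneg_left h hp).trans hu)
      fun h => (mul_le_mul_of_nonneg_left h hp).trans hv
  exact ⟨⟨k1 _ _ hx.1.1 hy.1.1, k1 _ _ hx.1.2 hy.1.2⟩, k2 _ _ hx.2.1 hy.2.1, k2 _ _ hx.2.2 hy.2.2⟩

/-! ### Duality of the lattices of the two forms -/

/-- The Cauchy-Schwarz inequality of the two forms. -/
theorem norm_dot_sq_le (ha : ¬ IsSquare (a : ZMod p)) (ξ x : Qn p 4) :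
    ‖ξ ⬝ᵥ x‖ ^ 2 ≤ p * (‖formCirc p a ξ‖ * ‖form p a x‖) := by
  have hp := cast_prime_pos (p := p)
  obtain ⟨⟨h0, h1⟩, h2, h3⟩ := (norm_form_le_iff ha x).mp le_rfl
  have hξ := (norm_form_le_iff ha (fun i => ξ i.rev)).mp le_rfl
  rw [← formCirc_eq] at hξ
  obtain ⟨⟨k3, k2⟩, k1, k0⟩ := hξ
  replace k3 : ‖ξ 3‖ ^ 2 ≤ _ := k3
  replace k2 : ‖ξ 2‖ ^ 2 ≤ _ := k2
  replace k1 : (p : ℝ)⁻¹ * ‖ξ 1‖ ^ 2 ≤ _ := k1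
  replace k0 : (p : ℝ)⁻¹ * ‖ξ 0‖ ^ 2 ≤ _ := k0
  set A := ‖formCirc p a ξ‖
  set B := ‖form p a x‖
  have hA : 0 ≤ A := norm_nonneg _
  have hB : 0 ≤ B := norm_nonneg _
  have hi : ∀ i, ‖ξ i * x i‖ ≤ Real.sqrt (p * (A * B)) := by
    intro i
    apply Real.le_sqrt_of_sq_le
    rw [norm_mul, mul_pow]
    have c1 : ∀ u v : ℝ, 0 ≤ u → 0 ≤ v → (p : ℝ)⁻¹ * u ≤ A → v ≤ B → u * v ≤ p * (A * B) := by
      intro u v hu hv h h'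
      have : u ≤ p * A := by rwa [inv_mul_le_iff₀ hp] at h
      calc u * v ≤ (p * A) * B := mul_le_mul this h' hv (by positivity)
        _ = _ := by ring
    have c2 : ∀ u v : ℝ, 0 ≤ u → 0 ≤ v → u ≤ A → (p : ℝ)⁻¹ * v ≤ B → u * v ≤ p * (A * B) := by
      intro u v hu hv h h'
      have : v ≤ p * B := by rwa [inv_mul_le_iff₀ hp] at h'
      calc u * v ≤ A * (p * B) := mul_le_mul h this hv hA
        _ = _ := by ring
    fin_cases i
    · exact c1 _ _ (sq_nonneg _) (sq_nonneg _) k0 h0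
    · exact c1 _ _ (sq_nonneg _) (sq_nonneg _) k1 h1
    · exact c2 _ _ (sq_nonneg _) (sq_nonneg _) k2 h2
    · exact c2 _ _ (sq_nonneg _) (sq_nonneg _) k3 h3
  have hs : ‖ξ ⬝ᵥ x‖ ≤ Real.sqrt (p * (A * B)) := by
    rw [dotProduct]
    exact IsUltrametricDist.norm_sum_le_of_forall_le_of_nonneg (Real.sqrt_nonneg _) fun i _ => hi i
  calc ‖ξ ⬝ᵥ x‖ ^ 2 ≤ Real.sqrt (p * (A * B)) ^ 2 := by gcongr
    _ = _ := Real.sq_sqrt (by positivity)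

theorem chi_dot_eq_one (ha : ¬ IsSquare (a : ZMod p)) {ξ x : Qn p 4} {m : ℤ}
    (hξ : ‖formCirc p a ξ‖ ≤ (p : ℝ) ^ m) (hx : ‖form p a x‖ ≤ (p : ℝ) ^ (-m)) :
    chi (-(ξ ⬝ᵥ x)) = 1 := by
  have hp1 := one_lt_cast_prime (p := p)
  have hp := cast_prime_pos (p := p)
  apply chi_eq_one
  rw [norm_neg]
  apply norm_le_one_of_sq_lt
  calc ‖ξ ⬝ᵥ x‖ ^ 2 ≤ p * (‖formCirc p a ξ‖ * ‖form p a x‖) := norm_dot_sq_le ha ξ x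
    _ ≤ p * ((p : ℝ) ^ m * (p : ℝ) ^ (-m)) := by gcongr
    _ = p := by rw [← zpow_add₀ hp.ne']; simp
    _ < (p : ℝ) ^ 2 := by nlinarith

/-- The bound of `chi_dot_eq_one` is sharp: `{|f| ≤ p^{-m}}` and `{|f°| ≤ p^m}` are dual lattices.
The witness is supported at a coordinate where `|f°(ξ)|` is attained. -/
theorem exists_chi_dot_ne_one (ha : ¬ IsSquare (a : ZMod p)) {ξ : Qn p 4} (hξ : ξ ≠ 0) :
    ∃ t : Qn p 4, ‖formCirc p a ξ‖ * ‖form p a t‖ = p ∧ chi (-(ξ ⬝ᵥ t)) ≠ 1 := by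
  have hp := cast_prime_pos (p := p)
  have hp0 : (p : ℚ_[p]) ≠ 0 := by exact_mod_cast (Fact.out : p.Prime).ne_zero
  have hf : ‖formCirc p a ξ‖ ≠ 0 :=
    norm_ne_zero_iff.mpr fun h => hξ (eq_zero_of_formCirc_eq_zero ha h)
  have hN := norm_form ha (fun i => ξ i.rev)
  rw [← formCirc_eq] at hN
  replace hN : ‖formCirc p a ξ‖
    = max (max ‖ξ 3‖ ‖ξ 2‖ ^ 2) ((p : ℝ)⁻¹ * max ‖ξ 1‖ ‖ξ 0‖ ^ 2) := hN
  have main : ∀ (i : Fin 4) (c d : ℝ), ‖formCirc p a ξ‖ = c * ‖ξ i‖ ^ 2 → c * d = (p : ℝ)⁻¹ →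
      (∀ u : ℚ_[p], ‖form p a (Pi.single i u)‖ = d * ‖u‖ ^ 2) →
      ∃ t : Qn p 4, ‖formCirc p a ξ‖ * ‖form p a t‖ = p ∧ chi (-(ξ ⬝ᵥ t)) ≠ 1 := by
    intro i c d h1 hcd h2
    have hi : ξ i ≠ 0 := by
      intro h0
      rw [h0] at h1
      simp [hf] at h1
    refine ⟨Pi.single i (-((p : ℚ_[p]) * ξ i)⁻¹), ?_, ?_⟩
    · rw [h1, h2, norm_neg, norm_inv, norm_mul, Padic.norm_p]
      have : ‖ξ i‖ ≠ 0 := norm_ne_zero_iff.mpr hi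
      calc _ = (c * d) * p ^ 2 := by field_simp
        _ = p := by rw [hcd]; field_simp
    · rw [dotProduct_single]
      have : -(ξ i * -((p : ℚ_[p]) * ξ i)⁻¹) = (p : ℚ_[p])⁻¹ := by field_simp
      rw [this]
      exact chi_inv_p_ne_one
  have hs : ∀ (i : Fin 4) (u : ℚ_[p]), ‖form p a (Pi.single i u)‖
      = max (max ‖(Pi.single i u : Qn p 4) 0‖ ‖(Pi.single i u : Qn p 4) 1‖ ^ 2)
        ((p : ℝ)⁻¹ * max ‖(Pi.single i u : Qn p 4) 2‖ ‖(Pi.single i u : Qn p 4) 3‖ ^ 2) :=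
    fun i u => norm_form ha _
  rcases max_choice (max ‖ξ 3‖ ‖ξ 2‖ ^ 2) ((p : ℝ)⁻¹ * max ‖ξ 1‖ ‖ξ 0‖ ^ 2) with h | h
  · rcases max_choice ‖ξ 3‖ ‖ξ 2‖ with h' | h'
    · exact main 3 1 (p : ℝ)⁻¹ (by rw [hN, h, h', one_mul]) (by simp) fun u => by
        rw [hs]; simp; positivity
    · exact main 2 1 (p : ℝ)⁻¹ (by rw [hN, h, h', one_mul]) (by simp) fun u => by
        rw [hs]; simp; positivity
  · rcases max_choice ‖ξ 1‖ ‖ξ 0‖ with h' | h'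
    · exact main 1 (p : ℝ)⁻¹ 1 (by rw [hN, h, h']) (by simp) fun u => by
        rw [hs]; simp
    · exact main 0 (p : ℝ)⁻¹ 1 (by rw [hN, h, h']) (by simp) fun u => by
        rw [hs]; simp

/-! ### Volumes of the lattices -/

variable (p a) in
/-- The lattice `{x | |f(x)|_p ≤ p^{-m}}`. -/
def lattice (m : ℤ) : Set (Qn p 4) := {x | ‖form p a x‖ ≤ (p : ℝ) ^ (-m)}

variable (p a) in
/-- The dual lattice `{ξ | |f°(ξ)|_p ≤ p^m}` of `lattice p a m`. -/
def latticeCirc (m : ℤ) : Set (Qn p 4) := {ξ | ‖formCirc p a ξ‖ ≤ (p : ℝ) ^ m}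

theorem measurableSet_lattice (m : ℤ) : MeasurableSet (lattice p a m) :=
  (isClosed_le continuous_form.norm continuous_const).measurableSet

theorem measurableSet_latticeCirc (m : ℤ) : MeasurableSet (latticeCirc p a m) :=
  (isClosed_le continuous_formCirc.norm continuous_const).measurableSet

theorem isOpen_lattice (m : ℤ) : IsOpen (lattice p a m) := by
  have : lattice p a m = {x | ‖form p a x‖ < (p : ℝ) ^ (-m + 1)} := by
    ext x
    exact Padic.norm_le_pow_iff_norm_lt_pow_add_one _ _
  rw [this]
  exact isOpen_lt continuous_form.norm continuous_const

theorem lattice_zero (ha : ¬ IsSquare (a : ZMod p)) :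
    lattice p a 0 = closedBall (0 : Qn p 4) 1 := by
  have hp1 := one_lt_cast_prime (p := p)
  have hp := cast_prime_pos (p := p)
  ext x
  rw [mem_closedBall_zero_iff, pi_norm_le_iff_of_nonneg zero_le_one]
  change ‖form p a x‖ ≤ (p : ℝ) ^ (-(0 : ℤ)) ↔ _
  rw [norm_form_le_iff ha, neg_zero, zpow_zero]
  have k1 : ∀ u : ℚ_[p], ‖u‖ ^ 2 ≤ 1 ↔ ‖u‖ ≤ 1 := fun u =>
    pow_le_one_iff_of_nonneg (norm_nonneg u) two_ne_zero
  have k2 : ∀ u : ℚ_[p], (p : ℝ)⁻¹ * ‖u‖ ^ 2 ≤ 1 ↔ ‖u‖ ≤ 1 := by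
    intro u
    rw [inv_mul_le_iff₀ hp, mul_one]
    refine ⟨fun h => norm_le_one_of_sq_lt (h.trans_lt (by nlinarith)), fun h => ?_⟩
    exact ((k1 u).mpr h).trans hp1.le
  rw [k1, k1, k2, k2, Fin.forall_fin_succ, Fin.forall_fin_succ, Fin.forall_fin_succ,
    Fin.forall_fin_one]
  exact ⟨fun h => ⟨h.1.1, h.1.2, h.2.1, h.2.2⟩, fun h => ⟨⟨h.1, h.2.1⟩, h.2.2.1, h.2.2.2⟩⟩

theorem mem_lattice_one_iff (ha : ¬ IsSquare (a : ZMod p)) (x : Qn p 4) :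
    x ∈ lattice p a 1 ↔ (‖x 0‖ < 1 ∧ ‖x 1‖ < 1) ∧ ‖x 2‖ ≤ 1 ∧ ‖x 3‖ ≤ 1 := by
  have hp1 := one_lt_cast_prime (p := p)
  have hp := cast_prime_pos (p := p)
  change ‖form p a x‖ ≤ (p : ℝ) ^ (-(1 : ℤ)) ↔ _
  rw [norm_form_le_iff ha, zpow_neg_one]
  have k1 : ∀ u : ℚ_[p], ‖u‖ ^ 2 ≤ (p : ℝ)⁻¹ ↔ ‖u‖ < 1 := by
    intro u
    refine ⟨fun h => ?_, fun h => ?_⟩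
    · exact lt_of_pow_lt_pow_left₀ 2 zero_le_one
        (by rw [one_pow]; exact h.trans_lt (inv_lt_one_of_one_lt₀ hp1))
    · have h2 : ‖u‖ ≤ (p : ℝ)⁻¹ := by
        have := (Padic.norm_le_pow_iff_norm_lt_pow_add_one u (-1)).mpr (by simpa using h)
        rwa [zpow_neg_one] at this
      calc ‖u‖ ^ 2 = ‖u‖ * ‖u‖ := sq _
        _ ≤ 1 * (p : ℝ)⁻¹ := mul_le_mul h.le h2 (norm_nonneg _) zero_le_one
        _ = _ := one_mul _
  have k2 : ∀ u : ℚ_[p], (p : ℝ)⁻¹ * ‖u‖ ^ 2 ≤ (p : ℝ)⁻¹ ↔ ‖u‖ ≤ 1 := by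
    intro u
    rw [inv_mul_le_iff₀ hp, mul_inv_cancel₀ hp.ne']
    exact pow_le_one_iff_of_nonneg (norm_nonneg u) two_ne_zero
  rw [k1, k1, k2, k2]

instance instRegularHaar (n : ℕ) : (haar p n).Regular :=
  inferInstanceAs (Measure.addHaarMeasure (unitBall p n)).Regular

theorem haar_unitBall (n : ℕ) : haar p n (closedBall 0 1) = 1 :=
  Measure.addHaarMeasure_self (K₀ := unitBall p n)

theorem exists_natCast_near {u : ℚ_[p]} (hu : ‖u‖ ≤ 1) : ∃ i : Fin p, ‖u - (i : ℕ)‖ < 1 := by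
  obtain ⟨u, rfl⟩ : ∃ z : ℤ_[p], (z : ℚ_[p]) = u := ⟨⟨u, hu⟩, rfl⟩
  obtain ⟨n, hn, h⟩ := PadicInt.exists_mem_range u
  refine ⟨⟨n, hn⟩, ?_⟩
  have := PadicInt.mem_nonunits.mp h
  rwa [PadicInt.norm_def, PadicInt.coe_sub, PadicInt.coe_natCast] at this

theorem eq_of_natCast_near {u : ℚ_[p]} {i j : Fin p} (hi : ‖u - (i : ℕ)‖ < 1)
    (hj : ‖u - (j : ℕ)‖ < 1) : i = j := by
  have h1 : ‖(((i : ℤ) - (j : ℤ) : ℤ) : ℚ_[p])‖ < 1 := by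
    have : (((i : ℤ) - (j : ℤ) : ℤ) : ℚ_[p]) = (u - (j : ℕ)) + -(u - (i : ℕ)) := by
      push_cast; ring
    rw [this]
    exact (IsUltrametricDist.norm_add_le_max _ _).trans_lt (max_lt hj (by rwa [norm_neg]))
  rw [← PadicInt.coe_intCast, ← PadicInt.norm_def, PadicInt.norm_int_lt_one_iff_dvd] at h1
  have := Int.eq_zero_of_abs_lt_dvd h1 (by rw [abs_lt]; omega)
  exact Fin.ext (by omega)

/-- `ℤ_p^4` is the disjoint union of `p²` translates of the lattice `{|f| ≤ p^{-1}}`. -/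
theorem sq_mul_haar_lattice_one (ha : ¬ IsSquare (a : ZMod p)) :
    (p : ℝ≥0∞) ^ 2 * haar p 4 (lattice p a 1) = 1 := by
  let v : Fin p × Fin p → Qn p 4 := fun c => ![-((c.1 : ℕ) : ℚ_[p]), -((c.2 : ℕ) : ℚ_[p]), 0, 0]
  let D : Fin p × Fin p → Set (Qn p 4) := fun c => (fun x => x + v c) ⁻¹' lattice p a 1
  have hmem : ∀ c x, x ∈ D c ↔ (‖x 0 - (c.1 : ℕ)‖ < 1 ∧ ‖x 1 - (c.2 : ℕ)‖ < 1) ∧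
      ‖x 2‖ ≤ 1 ∧ ‖x 3‖ ≤ 1 := by
    intro c x
    change x + v c ∈ lattice p a 1 ↔ _
    rw [mem_lattice_one_iff ha]
    simp [v, sub_eq_add_neg]
  have hD : ∀ c, haar p 4 (D c) = haar p 4 (lattice p a 1) := fun c =>
    measure_preimage_add_right _ _ _
  have hdisj : Pairwise (Function.onFun Disjoint D) := by
    intro c c' hne
    refine Set.disjoint_left.mpr fun x hx hx' => hne ?_
    rw [hmem] at hx hx'
    exact Prod.ext (eq_of_natCast_near hx.1.1 hx'.1.1) (eq_of_natCast_near hx.1.2 hx'.1.2)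
  have hU : (⋃ c, D c) = closedBall (0 : Qn p 4) 1 := by
    have hle : ∀ (u : ℚ_[p]) (i : Fin p), ‖u - (i : ℕ)‖ < 1 → ‖u‖ ≤ 1 := by
      intro u i h
      have : u = (u - (i : ℕ)) + ((i : ℤ) : ℚ_[p]) := by push_cast; ring
      rw [this]
      exact (IsUltrametricDist.norm_add_le_max _ _).trans (max_le h.le (Padic.norm_int_le_one _))
    ext x
    rw [Set.mem_iUnion, mem_closedBall_zero_iff, pi_norm_le_iff_of_nonneg zero_le_one,
      Fin.forall_fin_succ, Fin.forall_fin_succ, Fin.forall_fin_succ, Fin.forall_fin_one]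
    constructor
    · rintro ⟨c, hc⟩
      rw [hmem] at hc
      exact ⟨hle _ _ hc.1.1, hle _ _ hc.1.2, hc.2.1, hc.2.2⟩
    · rintro ⟨h0, h1, h2, h3⟩
      obtain ⟨i, hi⟩ := exists_natCast_near h0
      obtain ⟨j, hj⟩ := exists_natCast_near h1
      exact ⟨(i, j), (hmem _ _).mpr ⟨⟨hi, hj⟩, h2, h3⟩⟩
  have hm : ∀ c, MeasurableSet (D c) := fun c =>
    (measurable_add_const (v c)) (measurableSet_lattice 1)
  have h := measure_iUnion (μ := haar p 4) hdisj hm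
  rw [hU, haar_unitBall, tsum_fintype] at h
  simp only [hD, Finset.sum_const, Finset.card_univ, Fintype.card_prod, Fintype.card_fin,
    nsmul_eq_mul] at h
  rw [h, sq]
  push_cast
  rfl

variable (p) in
/-- The similarity `(x₁, x₂, x₃, x₄) ↦ (p x₃, p x₄, x₁, x₂)` of `f`, with factor `-p`. -/
def similarity : Qn p 4 ≃ₜ+ Qn p 4 where
  toFun x := ![p * x 2, p * x 3, x 0, x 1]
  invFun y := ![y 2, y 3, (p : ℚ_[p])⁻¹ * y 0, (p : ℚ_[p])⁻¹ * y 1]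
  left_inv x := by
    have hp0 : (p : ℚ_[p]) ≠ 0 := by exact_mod_cast (Fact.out : p.Prime).ne_zero
    funext i
    fin_cases i <;> simp [hp0]
  right_inv x := by
    have hp0 : (p : ℚ_[p]) ≠ 0 := by exact_mod_cast (Fact.out : p.Prime).ne_zero
    funext i
    fin_cases i <;> simp [hp0]
  map_add' x y := by
    funext i
    fin_cases i <;> simp [mul_add]
  continuous_toFun := by
    refine continuous_pi fun i => ?_
    fin_cases i <;> simp <;> fun_prop
  continuous_invFun := by
    refine continuous_pi fun i => ?_
    fin_cases i <;> simp <;> fun_prop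

theorem form_similarity (x : Qn p 4) : form p a (similarity p x) = -p * form p a x := by
  change form p a ![p * x 2, p * x 3, x 0, x 1] = _
  simp [form]
  ring

theorem similarity_preimage_lattice (m : ℤ) :
    similarity p ⁻¹' lattice p a (m + 1) = lattice p a m := by
  have hp := cast_prime_pos (p := p)
  ext x
  change ‖form p a (similarity p x)‖ ≤ (p : ℝ) ^ (-(m + 1)) ↔ ‖form p a x‖ ≤ (p : ℝ) ^ (-m)
  rw [form_similarity, norm_mul, norm_neg, Padic.norm_p, neg_add, zpow_add₀ hp.ne', zpow_neg_one,
    mul_comm, mul_le_mul_iff_left₀ (by positivity)]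

theorem haar_real_lattice (ha : ¬ IsSquare (a : ZMod p)) (m : ℤ) :
    (haar p 4).real (lattice p a m) = ((p : ℝ) ^ 2)⁻¹ ^ m := by
  have hp := cast_prime_pos (p := p)
  set c : ℝ≥0 := addEquivAddHaarChar (similarity p)
  have hstep : ∀ m : ℤ, (haar p 4).real (lattice p a (m + 1))
      = c * (haar p 4).real (lattice p a m) := by
    intro m
    have := addEquivAddHaarChar_smul_preimage (haar p 4) (X := lattice p a (m + 1)) (similarity p)
    rw [similarity_preimage_lattice] at this
    rw [Measure.real, ← this, Measure.real, ENNReal.smul_def, smul_eq_mul, ENNReal.toReal_mul]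
    rfl
  have h0 : (haar p 4).real (lattice p a 0) = 1 := by
    rw [Measure.real, lattice_zero ha, haar_unitBall]; rfl
  have hc' : (c : ℝ) = ((p : ℝ) ^ 2)⁻¹ := by
    have h1 := hstep 0
    rw [h0, mul_one, zero_add] at h1
    have h2 := congrArg ENNReal.toReal (sq_mul_haar_lattice_one ha)
    rw [ENNReal.toReal_mul] at h2
    rw [← h1]
    refine eq_inv_of_mul_eq_one_right ?_
    simpa [Measure.real] using h2
  rw [hc'] at hstep
  have hne : ((p : ℝ) ^ 2)⁻¹ ≠ 0 := by positivity
  induction m using Int.induction_on with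
  | zero => simpa using h0
  | succ n ih => rw [hstep, ih, zpow_add_one₀ hne, mul_comm]
  | pred n ih =>
    have := hstep (-(n : ℤ) - 1)
    rw [sub_add_cancel, ih] at this
    rw [zpow_sub_one₀ hne, this]
    field_simp

theorem haar_lattice_lt_top (ha : ¬ IsSquare (a : ZMod p)) (m : ℤ) :
    haar p 4 (lattice p a m) < ∞ := by
  have hp := cast_prime_pos (p := p)
  refine lt_top_iff_ne_top.mpr fun h => ?_
  have h1 := haar_real_lattice ha m
  rw [Measure.real, h, ENNReal.toReal_top] at h1
  have : (0 : ℝ) < ((p : ℝ) ^ 2)⁻¹ ^ m := by positivity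
  exact this.ne h1

variable (p) in
/-- Reversal of the coordinates of `ℚ_p^4`. -/
def reversal : Qn p 4 ≃ₜ+ Qn p 4 where
  toFun x := fun i => x i.rev
  invFun x := fun i => x i.rev
  left_inv x := by simp
  right_inv x := by simp
  map_add' x y := rfl
  continuous_toFun := by fun_prop
  continuous_invFun := by fun_prop

theorem haar_real_latticeCirc (ha : ¬ IsSquare (a : ZMod p)) (m : ℤ) :
    (haar p 4).real (latticeCirc p a m) = ((p : ℝ) ^ 2) ^ m := by
  have h1 : addEquivAddHaarChar (reversal p) = 1 := by
    have h := addEquivAddHaarChar_smul_preimage (haar p 4)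
      (X := closedBall (0 : Qn p 4) 1) (reversal p)
    have hpre : reversal p ⁻¹' closedBall (0 : Qn p 4) 1 = closedBall 0 1 := by
      ext x
      simp only [Set.mem_preimage, mem_closedBall_zero_iff, pi_norm_le_iff_of_nonneg zero_le_one]
      exact ⟨fun h i => by simpa [reversal] using h i.rev, fun h i => h i.rev⟩
    rw [hpre, haar_unitBall, ENNReal.smul_def, smul_eq_mul, mul_one] at h
    exact_mod_cast h
  have h := addEquivAddHaarChar_smul_preimage (haar p 4) (X := lattice p a (-m)) (reversal p)
  have hpre : reversal p ⁻¹' lattice p a (-m) = latticeCirc p a m := by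
    ext x
    change ‖form p a (fun i => x i.rev)‖ ≤ (p : ℝ) ^ (- -m) ↔ ‖formCirc p a x‖ ≤ _
    rw [formCirc_eq, neg_neg]
  rw [hpre, h1, one_smul] at h
  rw [Measure.real, h, ← Measure.real, haar_real_lattice ha, zpow_neg, inv_zpow, inv_inv]

theorem haar_singleton_zero (ha : ¬ IsSquare (a : ZMod p)) : haar p 4 {0} = 0 := by
  have hp1 := one_lt_cast_prime (p := p)
  have hle : ∀ n : ℕ, (haar p 4).real {0} ≤ ((p : ℝ) ^ 2)⁻¹ ^ n := by
    intro n
    have h := haar_real_lattice ha (n : ℤ)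
    rw [zpow_natCast] at h
    rw [← h]
    refine measureReal_mono ?_ (haar_lattice_lt_top ha _).ne
    rw [Set.singleton_subset_iff]
    change ‖form p a 0‖ ≤ _
    rw [(form_eq_zero_iff ha 0).mpr rfl, norm_zero]
    positivity
  have hlim : Tendsto (fun n : ℕ => ((p : ℝ) ^ 2)⁻¹ ^ n) atTop (𝓝 0) :=
    tendsto_pow_atTop_nhds_zero_of_lt_one (by positivity)
      (inv_lt_one_of_one_lt₀ (one_lt_pow₀ hp1 two_ne_zero))
  have h0 : (haar p 4).real {0} = 0 :=
    le_antisymm (ge_of_tendsto' hlim hle) measureReal_nonneg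
  exact (measureReal_eq_zero_iff (isCompact_singleton.measure_lt_top).ne).mp h0

/-! ### The Fourier transform of lattices and shells -/

/-- Orthogonality of characters: the integral of a character over a set invariant under a
translation on which the character is non-trivial vanishes. -/
theorem setIntegral_chi_eq_zero {n : ℕ} {S : Set (Qn p n)} (hS : MeasurableSet S) {z t : Qn p n}
    (hinv : ∀ x, x + t ∈ S ↔ x ∈ S) (hne : chi (-(z ⬝ᵥ t)) ≠ 1) :
    ∫ x in S, chi (-(z ⬝ᵥ x)) ∂(haar p n) = 0 := by
  set I := ∫ x in S, chi (-(z ⬝ᵥ x)) ∂(haar p n) with hI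
  have e1 : I = chi (-(z ⬝ᵥ t)) * I := by
    conv_lhs => rw [hI, ← integral_indicator hS, ← integral_add_right_eq_self _ t]
    rw [hI, ← integral_indicator hS, ← integral_const_mul]
    congr 1
    funext x
    by_cases hx : x ∈ S
    · rw [Set.indicator_of_mem ((hinv x).mpr hx), Set.indicator_of_mem hx, dotProduct_add, neg_add,
        chi_add]
      ring
    · rw [Set.indicator_of_notMem (fun h => hx ((hinv x).mp h)), Set.indicator_of_notMem hx,
        mul_zero]
  have e2 : (1 - chi (-(z ⬝ᵥ t))) * I = 0 := by linear_combination e1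
  rcases mul_eq_zero.mp e2 with e3 | e3
  · exact absurd (sub_eq_zero.mp e3).symm hne
  · exact e3

open Classical in
theorem integral_chi_lattice (ha : ¬ IsSquare (a : ZMod p)) (m : ℤ) (ξ : Qn p 4) :
    ∫ x in lattice p a m, chi (-(ξ ⬝ᵥ x)) ∂(haar p 4)
      = if ξ ∈ latticeCirc p a m then ((p : ℂ) ^ 2)⁻¹ ^ m else 0 := by
  have hp := cast_prime_pos (p := p)
  split_ifs with h
  · have : ∫ x in lattice p a m, chi (-(ξ ⬝ᵥ x)) ∂(haar p 4)
        = ∫ _x in lattice p a m, (1 : ℂ) ∂(haar p 4) :=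
      setIntegral_congr_fun (measurableSet_lattice m) fun x hx => chi_dot_eq_one ha h hx
    rw [this, setIntegral_const, haar_real_lattice ha]
    simp
  · have hlt : (p : ℝ) ^ m < ‖formCirc p a ξ‖ := not_le.mp h
    have hξ : ξ ≠ 0 := by
      rintro rfl
      rw [(formCirc_eq_zero_iff ha 0).mpr rfl, norm_zero] at hlt
      exact absurd hlt (not_lt.mpr (by positivity))
    obtain ⟨t, ht, hne⟩ := exists_chi_dot_ne_one ha hξ
    have ht' : ‖form p a t‖ ≤ (p : ℝ) ^ (-m) := by
      have h1 : (p : ℝ) ^ (m + 1) ≤ ‖formCirc p a ξ‖ := by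
        by_contra hcon
        exact h ((Padic.norm_le_pow_iff_norm_lt_pow_add_one _ _).mpr (not_le.mp hcon))
      have h2 : (p : ℝ) ^ (m + 1) * ‖form p a t‖ ≤ p := by
        exact (mul_le_mul_of_nonneg_right h1 (norm_nonneg _)).trans_eq ht
      rw [zpow_add_one₀ hp.ne', mul_assoc, mul_comm, mul_assoc] at h2
      have h3 : ‖form p a t‖ * (p : ℝ) ^ m ≤ 1 := by
        rwa [mul_le_iff_le_one_right hp] at h2
      rw [zpow_neg]
      exact (le_div_iff₀ (by positivity)).mpr h3 |>.trans_eq (one_div _)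
    refine setIntegral_chi_eq_zero (measurableSet_lattice m) (t := t) (fun x => ⟨fun hx => ?_,
      fun hx => norm_form_add_le ha hx ht'⟩) hne
    have : x = (x + t) + -t := by ring
    rw [this]
    exact norm_form_add_le ha hx (by rwa [form_neg])

variable (p a) in
/-- The shell `{x | |f(x)|_p = p^{-m}}`. -/
def shell (m : ℤ) : Set (Qn p 4) := {x | ‖form p a x‖ = (p : ℝ) ^ (-m)}

variable (p a) in
/-- The shell `{ξ | |f°(ξ)|_p = p^j}`. -/
def shellCirc (j : ℤ) : Set (Qn p 4) := {ξ | ‖formCirc p a ξ‖ = (p : ℝ) ^ j}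

theorem measurableSet_shell (m : ℤ) : MeasurableSet (shell p a m) :=
  (isClosed_eq continuous_form.norm continuous_const).measurableSet

theorem measurableSet_shellCirc (j : ℤ) : MeasurableSet (shellCirc p a j) :=
  (isClosed_eq continuous_formCirc.norm continuous_const).measurableSet

theorem norm_le_zpow_and_not_iff (u : ℚ_[p]) (j : ℤ) :
    ‖u‖ ≤ (p : ℝ) ^ j ∧ ¬ ‖u‖ ≤ (p : ℝ) ^ (j - 1) ↔ ‖u‖ = (p : ℝ) ^ j := by
  rw [← Padic.norm_lt_pow_iff_norm_le_pow_sub_one, not_lt]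
  exact ⟨fun h => le_antisymm h.1 h.2, fun h => ⟨h.le, h.ge⟩⟩

theorem shell_eq_diff (m : ℤ) : shell p a m = lattice p a m \ lattice p a (m + 1) := by
  ext x
  change ‖form p a x‖ = (p : ℝ) ^ (-m) ↔
    ‖form p a x‖ ≤ (p : ℝ) ^ (-m) ∧ ¬ ‖form p a x‖ ≤ (p : ℝ) ^ (-(m + 1))
  rw [← norm_le_zpow_and_not_iff, neg_add, sub_eq_add_neg]

theorem isOpen_shellCirc (j : ℤ) : IsOpen (shellCirc p a j) := by
  have : shellCirc p a j = formCirc p a ⁻¹' sphere 0 ((p : ℝ) ^ j) := by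
    ext x
    simp [shellCirc]
  rw [this]
  exact (IsUltrametricDist.isOpen_sphere 0
    (zpow_pos cast_prime_pos j).ne').preimage continuous_formCirc

theorem exists_mem_shell (ha : ¬ IsSquare (a : ZMod p)) {x : Qn p 4} (hx : x ≠ 0) :
    ∃ m, x ∈ shell p a m :=
  ⟨_, Padic.norm_eq_zpow_neg_valuation fun h => hx ((form_eq_zero_iff ha x).mp h)⟩

theorem exists_mem_shellCirc (ha : ¬ IsSquare (a : ZMod p)) {ξ : Qn p 4} (hξ : ξ ≠ 0) :
    ∃ j, ξ ∈ shellCirc p a j :=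
  ⟨_, Padic.norm_eq_zpow_neg_valuation fun h => hξ ((formCirc_eq_zero_iff ha ξ).mp h)⟩

theorem zero_notMem_shell (m : ℤ) : (0 : Qn p 4) ∉ shell p a m := by
  intro h
  have h' : ‖form p a 0‖ = (p : ℝ) ^ (-m) := h
  have : form p a 0 = 0 := by simp [form]
  rw [this, norm_zero] at h'
  exact (zpow_pos (cast_prime_pos (p := p)) (-m)).ne h'

theorem disjoint_shell : Pairwise (Function.onFun Disjoint (shell p a)) := by
  intro m m' hne
  refine Set.disjoint_left.mpr fun x (hx : _ = _) (hx' : _ = _) => hne ?_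
  have := zpow_right_injective₀ (cast_prime_pos (p := p)) (one_lt_cast_prime (p := p)).ne'
    (hx.symm.trans hx')
  omega

theorem eq_of_mem_shellCirc {i j : ℤ} {ξ : Qn p 4} (hi : ξ ∈ shellCirc p a i)
    (hj : ξ ∈ shellCirc p a j) : i = j :=
  zpow_right_injective₀ (cast_prime_pos (p := p)) (one_lt_cast_prime (p := p)).ne'
    (Eq.trans (Eq.symm hi) hj)

theorem iUnion_shell (ha : ¬ IsSquare (a : ZMod p)) : (⋃ m, shell p a m) = {0}ᶜ := by
  ext x
  rw [Set.mem_iUnion, Set.mem_compl_singleton_iff]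
  refine ⟨?_, exists_mem_shell ha⟩
  rintro ⟨m, hm⟩ rfl
  exact zero_notMem_shell m hm

variable (p) in
/-- The value on the shell `{|f°| = p^j}` of the Fourier transform of the indicator function of
the shell `{|f| = p^{-m}}`. -/
def shellKernel (m j : ℤ) : ℂ :=
  (if j ≤ m then ((p : ℂ) ^ 2)⁻¹ ^ m else 0) -
    if j ≤ m + 1 then ((p : ℂ) ^ 2)⁻¹ ^ (m + 1) else 0

theorem integral_chi_shell (ha : ¬ IsSquare (a : ZMod p)) (m : ℤ) {j : ℤ} {ξ : Qn p 4}
    (hξ : ξ ∈ shellCirc p a j) :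
    ∫ x in shell p a m, chi (-(ξ ⬝ᵥ x)) ∂(haar p 4) = shellKernel p m j := by
  have hsub : lattice p a (m + 1) ⊆ lattice p a m := fun x (hx : _ ≤ _) =>
    le_trans hx (zpow_le_zpow_right₀ one_lt_cast_prime.le (by omega))
  have hint : IntegrableOn (fun x : Qn p 4 => chi (-(ξ ⬝ᵥ x))) (lattice p a m) (haar p 4) := by
    refine Measure.integrableOn_of_bounded (M := 1) (haar_lattice_lt_top ha m).ne
      (continuous_chi_dot ξ).aestronglyMeasurable (Eventually.of_forall fun x => (chi_norm _).le)
  have hmem : ∀ k : ℤ, ξ ∈ latticeCirc p a k ↔ j ≤ k := by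
    intro k
    change ‖formCirc p a ξ‖ ≤ (p : ℝ) ^ k ↔ j ≤ k
    rw [show ‖formCirc p a ξ‖ = (p : ℝ) ^ j from hξ]
    exact zpow_le_zpow_iff_right₀ one_lt_cast_prime
  rw [shell_eq_diff, setIntegral_sdiff (measurableSet_lattice _) hint hsub,
    integral_chi_lattice ha, integral_chi_lattice ha, shellKernel]
  simp only [hmem]

/-! ### Integrals of Fourier transforms and Fourier inversion -/

theorem setIntegral_fourier {n : ℕ} {S : Set (Qn p n)} (hfin : haar p n S < ∞)
    {ψ : Qn p n → ℂ} (hψ : ψ ∈ BruhatSchwartz p n) :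
    ∫ x in S, fourier ψ x ∂(haar p n)
      = ∫ w, (∫ x in S, chi (-(w ⬝ᵥ x)) ∂(haar p n)) * ψ w ∂(haar p n) := by
  have : IsFiniteMeasure ((haar p n).restrict S) :=
    ⟨by rwa [Measure.restrict_apply_univ]⟩
  have hsw : ∫ x in S, (∫ w, chi (-(x ⬝ᵥ w)) * ψ w ∂(haar p n)) ∂(haar p n)
      = ∫ w, (∫ x in S, chi (-(x ⬝ᵥ w)) * ψ w ∂(haar p n)) ∂(haar p n) := by
    apply integral_integral_swap
    have hi : Integrable ψ (haar p n) := hψ.1.continuous.integrable_of_hasCompactSupport hψ.2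
    have h1 : Integrable (fun _ : Qn p n => (1 : ℂ)) ((haar p n).restrict S) := integrable_const 1
    refine (h1.mul_prod hi).mono ?_ ?_
    · refine Continuous.aestronglyMeasurable ?_
      have hc : Continuous (chi : ℚ_[p] → ℂ) := chi_isLocallyConstant.continuous
      have hψc := hψ.1.continuous
      simp only [Function.uncurry_def, dotProduct]
      fun_prop
    · refine Eventually.of_forall fun z => ?_
      simp [Function.uncurry_def, chi_norm]
  simp only [fourier]
  rw [hsw]
  congr 1
  funext w
  rw [integral_mul_const]
  simp only [dotProduct_comm]

theorem norm_form_le_sq (ha : ¬ IsSquare (a : ZMod p)) (x : Qn p 4) :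
    ‖form p a x‖ ≤ ‖x‖ ^ 2 := by
  have hp1 := one_lt_cast_prime (p := p)
  have h : ∀ i, ‖x i‖ ^ 2 ≤ ‖x‖ ^ 2 := fun i => by
    have := norm_le_pi_norm x i
    gcongr
  have h' : ∀ i, (p : ℝ)⁻¹ * ‖x i‖ ^ 2 ≤ ‖x‖ ^ 2 := fun i =>
    (mul_le_of_le_one_left (sq_nonneg _) (inv_le_one_of_one_le₀ hp1.le)).trans (h i)
  exact (norm_form_le_iff ha x).mpr ⟨⟨h 0, h 1⟩, h' 2, h' 3⟩

theorem norm_sq_le_mul_norm_form (ha : ¬ IsSquare (a : ZMod p)) (x : Qn p 4) :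
    ‖x‖ ^ 2 ≤ p * ‖form p a x‖ := by
  have hp1 := one_lt_cast_prime (p := p)
  have hp := cast_prime_pos (p := p)
  obtain ⟨⟨h0, h1⟩, h2, h3⟩ := (norm_form_le_iff ha x).mp le_rfl
  rw [inv_mul_le_iff₀ hp] at h2 h3
  have hle : ‖form p a x‖ ≤ p * ‖form p a x‖ := le_mul_of_one_le_left (norm_nonneg _) hp1.le
  have hx : ‖x‖ ≤ Real.sqrt (p * ‖form p a x‖) := by
    refine (pi_norm_le_iff_of_nonneg (Real.sqrt_nonneg _)).mpr fun i => Real.le_sqrt_of_sq_le ?_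
    fin_cases i
    · exact h0.trans hle
    · exact h1.trans hle
    · exact h2
    · exact h3
  calc ‖x‖ ^ 2 ≤ Real.sqrt (p * ‖form p a x‖) ^ 2 := by gcongr
    _ = _ := Real.sq_sqrt (by positivity)

theorem norm_sq_le_mul_norm_formCirc (ha : ¬ IsSquare (a : ZMod p)) (ξ : Qn p 4) :
    ‖ξ‖ ^ 2 ≤ p * ‖formCirc p a ξ‖ := by
  rw [formCirc_eq]
  refine le_trans ?_ (norm_sq_le_mul_norm_form ha _)
  have : ‖ξ‖ ≤ ‖fun i : Fin 4 => ξ i.rev‖ :=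
    (pi_norm_le_iff_of_nonneg (norm_nonneg _)).mpr fun i => by
      simpa using norm_le_pi_norm (fun i : Fin 4 => ξ i.rev) i.rev
  gcongr

theorem exists_lattice_subset (ha : ¬ IsSquare (a : ZMod p)) {R r : ℝ} (hr : 0 < r) :
    ∃ M : ℕ, (∀ x : Qn p 4, ‖x‖ ≤ R → x ∈ lattice p a (-(M : ℤ))) ∧
      ∀ ξ ∈ latticeCirc p a (-(M : ℤ)), ‖ξ‖ < r := by
  have hp1 := one_lt_cast_prime (p := p)
  have hp := cast_prime_pos (p := p)
  -- The first bound gives `|f(x)| ≤ R² ≤ p^M`, the second `‖ξ‖² ≤ p · p^{-M} < r²`.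
  obtain ⟨M, hM⟩ := pow_unbounded_of_one_lt (max (R ^ 2) (p / r ^ 2)) hp1
  refine ⟨M, fun x hx => ?_, fun ξ hξ => ?_⟩
  · change ‖form p a x‖ ≤ (p : ℝ) ^ (-(-(M : ℤ)))
    rw [neg_neg, zpow_natCast]
    have : ‖x‖ ^ 2 ≤ R ^ 2 := by gcongr
    exact ((norm_form_le_sq ha x).trans this).trans ((le_max_left _ _).trans hM.le)
  · have h1 : ‖formCirc p a ξ‖ ≤ (p : ℝ) ^ (-(M : ℤ)) := hξ
    rw [zpow_neg, zpow_natCast] at h1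
    have h2 : p / r ^ 2 < (p : ℝ) ^ M := (le_max_right _ _).trans_lt hM
    rw [div_lt_iff₀ (by positivity)] at h2
    refine lt_of_pow_lt_pow_left₀ 2 hr.le ?_
    calc ‖ξ‖ ^ 2 ≤ p * ‖formCirc p a ξ‖ := norm_sq_le_mul_norm_formCirc ha ξ
      _ ≤ p * ((p : ℝ) ^ M)⁻¹ := by gcongr
      _ < r ^ 2 := by rw [← div_eq_mul_inv, div_lt_iff₀ (by positivity)]; linarith

/-- Fourier inversion at the origin. Over a large lattice the integral of `F ψ` is the mean of `ψ`
over a small neighbourhood of the origin. -/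
theorem integral_fourier (ha : ¬ IsSquare (a : ZMod p)) {ψ : Qn p 4 → ℂ}
    (hψ : ψ ∈ BruhatSchwartz p 4) : ∫ x, fourier ψ x ∂(haar p 4) = ψ 0 := by
  classical
  have hp := cast_prime_pos (p := p)
  obtain ⟨r, hr, hinv⟩ := exists_invariant hψ
  obtain ⟨R, -, hsupp⟩ := exists_support_bound (fourier_mem hψ)
  obtain ⟨M, hM1, hM2⟩ := exists_lattice_subset (a := a) ha (R := R) hr
  have e1 : ∫ x, fourier ψ x ∂(haar p 4) = ∫ x in lattice p a (-(M : ℤ)), fourier ψ x ∂(haar p 4) :=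
    (setIntegral_eq_integral_of_forall_compl_eq_zero fun x hx =>
      hsupp x (not_le.mp fun h => hx (hM1 x h))).symm
  rw [e1, setIntegral_fourier (haar_lattice_lt_top ha _) hψ]
  have e2 : ∀ w, (∫ x in lattice p a (-(M : ℤ)), chi (-(w ⬝ᵥ x)) ∂(haar p 4)) * ψ w
      = (latticeCirc p a (-(M : ℤ))).indicator
        (fun _ => ((p : ℂ) ^ 2)⁻¹ ^ (-(M : ℤ)) * ψ 0) w := by
    intro w
    rw [integral_chi_lattice ha]
    by_cases hw : w ∈ latticeCirc p a (-(M : ℤ))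
    · have := hinv 0 w (hM2 w hw)
      rw [zero_add] at this
      rw [if_pos hw, Set.indicator_of_mem hw, this]
    · rw [if_neg hw, Set.indicator_of_notMem hw, zero_mul]
  simp only [e2]
  have hne : (p : ℂ) ≠ 0 := by exact_mod_cast (Fact.out : p.Prime).ne_zero
  rw [integral_indicator (measurableSet_latticeCirc _), setIntegral_const,
    haar_real_latticeCirc ha, Complex.real_smul]
  push_cast
  rw [← mul_assoc, inv_zpow, mul_inv_cancel₀ (zpow_ne_zero _ (pow_ne_zero _ hne)), one_mul]

theorem fourier_fourier (hn : ∃ a : ℤ, ¬ IsSquare (a : ZMod p)) {ψ : Qn p 4 → ℂ}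
    (hψ : ψ ∈ BruhatSchwartz p 4) (y : Qn p 4) : fourier (fourier ψ) y = ψ (-y) := by
  obtain ⟨a, ha⟩ := hn
  have hτ : (fun w => ψ (w - y)) ∈ BruhatSchwartz p 4 :=
    ⟨hψ.1.comp_continuous (f := fun w : Qn p 4 => w - y) (by fun_prop),
      hψ.2.comp_homeomorph (Homeomorph.subRight y)⟩
  have h := integral_fourier ha hτ
  rw [zero_sub] at h
  rw [← h, fourier]
  congr 1
  funext x
  rw [fourier, fourier, ← integral_const_mul,
    ← integral_sub_right_eq_self (fun w => chi (-(y ⬝ᵥ x)) * (chi (-(x ⬝ᵥ w)) * ψ w)) y]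
  congr 1
  funext w
  rw [← mul_assoc, ← chi_add, dotProduct_sub, dotProduct_comm x y]
  congr 2
  ring

/-! ### Radial multipliers on `Ψ` -/

/-- Multiplication by a function of `|f°|` preserves `Ψ`; its value at the origin is irrelevant. -/
theorem radial_mul_mem_psi (ha : ¬ IsSquare (a : ZMod p)) {κ : Qn p 4 → ℂ} {k : ℤ → ℂ}
    (hκ : ∀ j, ∀ ξ ∈ shellCirc p a j, κ ξ = k j) {ψ : Qn p 4 → ℂ} (hψ : ψ ∈ Psi p 4) :
    (fun ξ => κ ξ * ψ ξ) ∈ Psi p 4 := by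
  refine ⟨⟨?_, hψ.1.2.mul_left⟩, by simp [hψ.2]⟩
  rw [IsLocallyConstant.iff_eventually_eq]
  intro ξ
  have h := (IsLocallyConstant.iff_eventually_eq ψ).mp hψ.1.1 ξ
  by_cases hξ : ξ = 0
  · filter_upwards [h] with η hη
    rw [hη, hξ, hψ.2, mul_zero, mul_zero]
  · obtain ⟨j, hj⟩ := exists_mem_shellCirc ha hξ
    filter_upwards [h, (isOpen_shellCirc j).mem_nhds hj] with η hη hη'
    rw [hη, hκ j η hη', hκ j ξ hj]

theorem integrable_of_mem_psi {n : ℕ} {ψ : Qn p n → ℂ} (hψ : ψ ∈ Psi p n) :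
    Integrable ψ (haar p n) :=
  hψ.1.1.continuous.integrable_of_hasCompactSupport hψ.1.2

/-- A test function in `Ψ` meets only finitely many shells of `f°`, so that integrating it against
a function of `|f°|` amounts to a finite sum. -/
theorem exists_radial_decomposition (ha : ¬ IsSquare (a : ZMod p)) {ψ : Qn p 4 → ℂ}
    (hψ : ψ ∈ Psi p 4) : ∃ (s : Finset ℤ) (B : ℤ → ℂ), ∀ (κ : Qn p 4 → ℂ) (k : ℤ → ℂ),
      (∀ j, ∀ ξ ∈ shellCirc p a j, κ ξ = k j) →
      ∫ ξ, κ ξ * ψ ξ ∂(haar p 4) = ∑ j ∈ s, k j * B j := by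
  have hcl : IsClosed (Function.support ψ) := (hψ.1.1.isOpen_fiber 0).isClosed_compl
  have hK : IsCompact (Function.support ψ) := by
    have := hψ.1.2
    rwa [HasCompactSupport, tsupport, hcl.closure_eq] at this
  obtain ⟨s, hs⟩ := hK.elim_finite_subcover (shellCirc p a) isOpen_shellCirc fun ξ hξ => by
    have : ξ ≠ 0 := by
      rintro rfl
      exact hξ hψ.2
    exact Set.mem_iUnion.mpr (exists_mem_shellCirc ha this)
  refine ⟨s, fun j => ∫ ξ in shellCirc p a j, ψ ξ ∂(haar p 4), fun κ k hκ => ?_⟩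
  have e : ∀ ξ, κ ξ * ψ ξ = ∑ j ∈ s, (shellCirc p a j).indicator (fun ξ => k j * ψ ξ) ξ := by
    intro ξ
    by_cases h0 : ψ ξ = 0
    · rw [h0, mul_zero]
      refine (Finset.sum_eq_zero fun j _ => ?_).symm
      by_cases hj : ξ ∈ shellCirc p a j
      · rw [Set.indicator_of_mem hj, h0, mul_zero]
      · rw [Set.indicator_of_notMem hj]
    · obtain ⟨j, hjs, hj⟩ : ∃ j ∈ s, ξ ∈ shellCirc p a j := by
        simpa using hs (show ξ ∈ Function.support ψ from h0)
      rw [Finset.sum_eq_single_of_mem j hjs, Set.indicator_of_mem hj, hκ j ξ hj]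
      intro i _ hij
      exact Set.indicator_of_notMem (fun hi => hij (eq_of_mem_shellCirc hi hj)) _
  simp only [e]
  have hint := integrable_of_mem_psi hψ
  rw [integral_finsetSum _ fun j _ => (hint.const_mul (k j)).indicator (measurableSet_shellCirc j)]
  refine Finset.sum_congr rfl fun j _ => ?_
  rw [integral_indicator (measurableSet_shellCirc j), integral_const_mul]

theorem norm_inv_sq_cast (p : ℕ) : ‖((p : ℂ) ^ 2)⁻¹‖ = ((p : ℝ) ^ 2)⁻¹ := by simp

theorem summable_zpow {p : ℕ} {q : ℂ} (hq0 : q ≠ 0) (hq : ‖q * ((p : ℂ) ^ 2)⁻¹‖ < 1) (M : ℤ) :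
    Summable fun n : ℕ => ‖q ^ (M + n)‖ * ((p : ℝ) ^ 2)⁻¹ ^ n := by
  rw [norm_mul, norm_inv_sq_cast] at hq
  have := (summable_geometric_of_lt_one (by positivity) hq).mul_left (‖q‖ ^ M)
  refine this.congr fun n => ?_
  rw [norm_zpow, zpow_add₀ (norm_ne_zero_iff.mpr hq0), zpow_natCast, mul_pow, mul_assoc]

/-! ### Pairing radial functions with Fourier transforms -/

theorem locallyIntegrable_radial (ha : ¬ IsSquare (a : ZMod p)) {g : Qn p 4 → ℂ} {h : ℤ → ℂ}
    (hg : ∀ m, ∀ x ∈ shell p a m, g x = h m)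
    (hs : ∀ M : ℤ, Summable fun n : ℕ => ‖h (M + n)‖ * ((p : ℝ) ^ 2)⁻¹ ^ n) :
    LocallyIntegrable g (haar p 4) := by
  have hp := cast_prime_pos (p := p)
  have hp1 := one_lt_cast_prime (p := p)
  intro x
  obtain ⟨N, hN, -⟩ := exists_lattice_subset (a := a) ha (R := ‖x‖) one_pos
  set M : ℤ := -(N : ℤ)
  refine ⟨lattice p a M, (isOpen_lattice M).mem_nhds (hN x le_rfl), ?_⟩
  have hsub : lattice p a M ⊆ {0} ∪ ⋃ n : ℕ, shell p a (M + n) := by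
    intro y (hy : ‖form p a y‖ ≤ _)
    rcases eq_or_ne y 0 with rfl | h0
    · exact Or.inl rfl
    · obtain ⟨m, hm⟩ := exists_mem_shell ha h0
      rw [show ‖form p a y‖ = (p : ℝ) ^ (-m) from hm, zpow_le_zpow_iff_right₀ hp1] at hy
      refine Or.inr (Set.mem_iUnion.mpr ⟨(m - M).toNat, ?_⟩)
      rwa [Int.toNat_of_nonneg (by omega), add_sub_cancel]
  have hshell : ∀ m, shell p a m ⊆ lattice p a m := fun m y hy => le_of_eq hy
  have htop : ∀ m, haar p 4 (shell p a m) < ∞ := fun m =>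
    (measure_mono (hshell m)).trans_lt (haar_lattice_lt_top ha m)
  refine IntegrableOn.mono_set (IntegrableOn.union ?_ ?_) hsub
  · rw [IntegrableOn, Measure.restrict_eq_zero.mpr (haar_singleton_zero ha)]
    exact integrable_zero_measure
  · refine integrableOn_iUnion_of_summable_integral_norm (fun n => ?_) ?_
    · exact (integrableOn_const (C := h (M + n)) (htop _).ne).congr_fun
        (fun y hy => (hg _ y hy).symm) (measurableSet_shell _)
    · refine Summable.of_nonneg_of_le (fun n => integral_nonneg fun y => norm_nonneg _)
        (fun n => ?_) ((hs M).mul_left (((p : ℝ) ^ 2)⁻¹ ^ M))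
      have e : ∫ y in shell p a (M + n), ‖g y‖ ∂(haar p 4)
          = (haar p 4).real (shell p a (M + n)) * ‖h (M + n)‖ := by
        rw [setIntegral_congr_fun (measurableSet_shell _)
          (fun y hy => congrArg norm (hg _ y hy)), setIntegral_const, smul_eq_mul]
      have hv : (haar p 4).real (shell p a (M + n)) ≤ ((p : ℝ) ^ 2)⁻¹ ^ (M + n) := by
        rw [← haar_real_lattice ha]
        exact measureReal_mono (hshell _) (haar_lattice_lt_top ha _).ne
      rw [e]
      calc _ ≤ ((p : ℝ) ^ 2)⁻¹ ^ (M + n) * ‖h (M + n)‖ := by gcongr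
        _ = _ := by
          rw [zpow_add₀ (by positivity), zpow_natCast]
          ring

/-- The Fourier transform of a radial function `g` on `ℚ_p^4`, as an element of `Ψ'`, is the radial
function `κ` obtained from `g` by summation against the transforms of the shells. -/
theorem integral_radial_mul_fourier (ha : ¬ IsSquare (a : ZMod p)) {g κ : Qn p 4 → ℂ}
    {h k : ℤ → ℂ} (hg : ∀ m, ∀ x ∈ shell p a m, g x = h m)
    (hloc : LocallyIntegrable g (haar p 4))
    (hκ : ∀ j, ∀ ξ ∈ shellCirc p a j, κ ξ = k j)
    (hsum : ∀ j, HasSum (fun m => h m * shellKernel p m j) (k j))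
    {ψ : Qn p 4 → ℂ} (hψ : ψ ∈ Psi p 4) :
    ∫ x, g x * fourier ψ x ∂(haar p 4) = ∫ ξ, κ ξ * ψ ξ ∂(haar p 4) := by
  obtain ⟨s, B, hB⟩ := exists_radial_decomposition ha hψ
  have hint : Integrable (fun x => g x * fourier ψ x) (haar p 4) :=
    integrable_mul_phi hloc ⟨⟨ψ, hψ⟩, rfl⟩
  have h1 := hasSum_integral_iUnion (μ := haar p 4) (f := fun x => g x * fourier ψ x)
    (fun m => measurableSet_shell (p := p) (a := a) m) disjoint_shell hint.integrableOn
  have hae : ∀ᵐ x ∂(haar p 4), x ∈ ({0}ᶜ : Set (Qn p 4)) :=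
    compl_mem_ae_iff.mpr (haar_singleton_zero ha)
  rw [iUnion_shell ha, Measure.restrict_eq_self_of_ae_mem hae] at h1
  have h2 : ∀ m, ∫ x in shell p a m, g x * fourier ψ x ∂(haar p 4)
      = ∑ j ∈ s, h m * shellKernel p m j * B j := by
    intro m
    have htop : haar p 4 (shell p a m) < ∞ :=
      (measure_mono fun y hy => le_of_eq hy).trans_lt (haar_lattice_lt_top ha m)
    rw [setIntegral_congr_fun (measurableSet_shell m)
      (g := fun x => h m * fourier ψ x) (fun x hx => by simp only [hg m x hx]),
      integral_const_mul, setIntegral_fourier htop hψ.1,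
      hB _ (shellKernel p m) (fun j ξ hξ => integral_chi_shell ha m hξ), Finset.mul_sum]
    exact Finset.sum_congr rfl fun j _ => (mul_assoc _ _ _).symm
  simp only [h2] at h1
  rw [hB κ k hκ]
  exact h1.unique (hasSum_sum fun j _ => (hsum j).mul_right (B j))

/-- Summation by parts: pairing with `shellKernel` reduces to a one-sided power series. -/
theorem hasSum_mul_shellKernel {h : ℤ → ℂ} {j : ℤ} {S : ℂ}
    (hS : HasSum (fun n : ℕ => h (j + n) * ((p : ℂ) ^ 2)⁻¹ ^ n) S) :
    HasSum (fun m => h m * shellKernel p m j)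
      (((p : ℂ) ^ 2)⁻¹ ^ j * ((1 - ((p : ℂ) ^ 2)⁻¹) * S - h (j - 1))) := by
  have hne : ((p : ℂ) ^ 2)⁻¹ ≠ 0 :=
    inv_ne_zero (pow_ne_zero _ (by exact_mod_cast (Fact.out : p.Prime).ne_zero))
  have hinj : Function.Injective fun n : ℕ => j - 1 + (n : ℤ) := fun m n (h : _ = _) => by
    simpa using h
  -- Only the terms with `m ≥ j - 1` contribute; the term `m = j - 1` is the boundary term.
  refine (hinj.hasSum_iff fun m hm => ?_).mp ?_
  · have : m < j - 1 := by
      by_contra hlt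
      exact hm ⟨(m - (j - 1)).toNat, by simp only; rw [Int.toNat_of_nonneg (by omega)]; ring⟩
    rw [shellKernel, if_neg (by omega), if_neg (by omega), sub_zero, mul_zero]
  · have e0 : ((fun m => h m * shellKernel p m j) ∘ fun n : ℕ => j - 1 + (n : ℤ)) 0
        = -(((p : ℂ) ^ 2)⁻¹ ^ j * h (j - 1)) := by
      simp only [Function.comp, Nat.cast_zero, add_zero, shellKernel]
      rw [if_neg (by omega), if_pos (by omega), sub_add_cancel]
      ring
    have e1 : ∀ n : ℕ, ((fun m => h m * shellKernel p m j) ∘ fun n : ℕ => j - 1 + (n : ℤ)) (n + 1)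
        = ((p : ℂ) ^ 2)⁻¹ ^ j * (1 - ((p : ℂ) ^ 2)⁻¹) * (h (j + n) * ((p : ℂ) ^ 2)⁻¹ ^ n) := by
      intro n
      have : j - 1 + ((n + 1 : ℕ) : ℤ) = j + n := by push_cast; ring
      simp only [Function.comp, this, shellKernel]
      rw [if_pos (by omega), if_pos (by omega), zpow_add_one₀ hne, zpow_add₀ hne, zpow_natCast]
      ring
    rw [← hasSum_nat_add_iff' 1]
    simp only [e1, Finset.sum_range_one, e0]
    have e2 : ((p : ℂ) ^ 2)⁻¹ ^ j * ((1 - ((p : ℂ) ^ 2)⁻¹) * S - h (j - 1))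
        - -(((p : ℂ) ^ 2)⁻¹ ^ j * h (j - 1))
        = ((p : ℂ) ^ 2)⁻¹ ^ j * (1 - ((p : ℂ) ^ 2)⁻¹) * S := by ring
    rw [e2]
    exact hS.mul_left _

theorem inv_sq_cast_lt_one : ((p : ℝ) ^ 2)⁻¹ < 1 :=
  inv_lt_one_of_one_lt₀ (one_lt_pow₀ one_lt_cast_prime two_ne_zero)

theorem hasSum_zpow_mul_shellKernel {q : ℂ} (hq0 : q ≠ 0) (hq : ‖q * ((p : ℂ) ^ 2)⁻¹‖ < 1)
    (j : ℤ) : HasSum (fun m => q ^ m * shellKernel p m j)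
      ((1 - q⁻¹) / (1 - q * ((p : ℂ) ^ 2)⁻¹) * (q * ((p : ℂ) ^ 2)⁻¹) ^ j) := by
  have h := ((hasSum_geometric_of_norm_lt_one hq).mul_left (q ^ j))
  have hS : HasSum (fun n : ℕ => q ^ (j + n) * ((p : ℂ) ^ 2)⁻¹ ^ n)
      (q ^ j * (1 - q * ((p : ℂ) ^ 2)⁻¹)⁻¹) := by
    refine h.congr_fun fun n => ?_
    rw [zpow_add₀ hq0, zpow_natCast, mul_pow, mul_assoc]
  convert hasSum_mul_shellKernel (h := fun m => q ^ m) hS using 1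
  have hne : 1 - q * ((p : ℂ) ^ 2)⁻¹ ≠ 0 := by
    intro h0
    rw [← sub_eq_zero.mp h0, norm_one] at hq
    exact lt_irrefl _ hq
  rw [mul_zpow, zpow_sub_one₀ hq0]
  generalize ((p : ℂ) ^ 2)⁻¹ = b at *
  field_simp
  ring

theorem hasSum_intCast_mul_shellKernel (j : ℤ) :
    HasSum (fun m : ℤ => (m : ℂ) * shellKernel p m j)
      ((1 - ((p : ℂ) ^ 2)⁻¹)⁻¹ * ((p : ℂ) ^ 2)⁻¹ ^ j) := by
  have hb : ‖((p : ℂ) ^ 2)⁻¹‖ < 1 := by rw [norm_inv_sq_cast]; exact inv_sq_cast_lt_one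
  have hS : HasSum (fun n : ℕ => ((j + n : ℤ) : ℂ) * ((p : ℂ) ^ 2)⁻¹ ^ n)
      (j * (1 - ((p : ℂ) ^ 2)⁻¹)⁻¹ + ((p : ℂ) ^ 2)⁻¹ / (1 - ((p : ℂ) ^ 2)⁻¹) ^ 2) := by
    refine (((hasSum_geometric_of_norm_lt_one hb).mul_left (j : ℂ)).add
      (hasSum_coe_mul_geometric_of_norm_lt_one hb)).congr_fun fun n => ?_
    push_cast
    ring
  convert hasSum_mul_shellKernel (h := fun m => (m : ℂ)) hS using 1
  have hne : 1 - ((p : ℂ) ^ 2)⁻¹ ≠ 0 := by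
    intro h0
    rw [← sub_eq_zero.mp h0, norm_one] at hb
    exact lt_irrefl _ hb
  push_cast
  generalize ((p : ℂ) ^ 2)⁻¹ = b at *
  field_simp
  ring

theorem summable_intCast (M : ℤ) :
    Summable fun n : ℕ => ‖((M + n : ℤ) : ℂ)‖ * ((p : ℝ) ^ 2)⁻¹ ^ n := by
  have hb : ‖((p : ℝ) ^ 2)⁻¹‖ < 1 := by
    rw [Real.norm_of_nonneg (by positivity)]; exact inv_sq_cast_lt_one
  have h := ((hasSum_geometric_of_norm_lt_one hb).mul_left (‖(M : ℂ)‖)).add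
    (hasSum_coe_mul_geometric_of_norm_lt_one hb)
  refine Summable.of_nonneg_of_le (fun n => by positivity) (fun n => ?_) h.summable
  rw [← add_mul]
  gcongr
  push_cast
  exact (norm_add_le _ _).trans (by simp)

/-! ### The functional equation of the local zeta function -/

theorem cast_prime_ne_zero : (p : ℂ) ≠ 0 := by exact_mod_cast (Fact.out : p.Prime).ne_zero

theorem zpow_cpow (j : ℤ) (s : ℂ) : (((p : ℝ) ^ j : ℝ) : ℂ) ^ s = ((p : ℂ) ^ s) ^ j := by
  have hp := cast_prime_pos (p := p)
  have hpj : (0 : ℝ) < (p : ℝ) ^ j := zpow_pos hp j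
  rw [Complex.cpow_def_of_ne_zero (by exact_mod_cast hpj.ne'),
    Complex.cpow_def_of_ne_zero cast_prime_ne_zero, ← Complex.exp_int_mul, ← Complex.ofReal_log hpj.le,
    Real.log_zpow, ← Complex.natCast_log]
  congr 1
  push_cast
  ring

theorem cpow_norm_form_of_mem_shell (s : ℂ) {m : ℤ} {x : Qn p 4} (hx : x ∈ shell p a m) :
    ((‖form p a x‖ : ℝ) : ℂ) ^ s = ((p : ℂ) ^ (-s)) ^ m := by
  rw [show ‖form p a x‖ = (p : ℝ) ^ (-m) from hx, zpow_cpow, Complex.cpow_neg, inv_zpow, zpow_neg]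

theorem cpow_norm_formCirc_of_mem_shellCirc (s : ℂ) {j : ℤ} {ξ : Qn p 4}
    (hξ : ξ ∈ shellCirc p a j) : ((‖formCirc p a ξ‖ : ℝ) : ℂ) ^ s = ((p : ℂ) ^ s) ^ j := by
  rw [show ‖formCirc p a ξ‖ = (p : ℝ) ^ j from hξ, zpow_cpow]

theorem cpow_neg_mul_inv_sq (s : ℂ) :
    (p : ℂ) ^ (-s) * ((p : ℂ) ^ 2)⁻¹ = (p : ℂ) ^ (-s - 2) := by
  rw [Complex.cpow_sub _ _ cast_prime_ne_zero, div_eq_mul_inv]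
  norm_num

theorem cpow_ne_zero (s : ℂ) : (p : ℂ) ^ s ≠ 0 := fun h =>
  cast_prime_ne_zero ((Complex.cpow_eq_zero_iff _ _).mp h).1

theorem cpow_ne_one {s : ℂ} (hs : s.re ≠ 0) : (p : ℂ) ^ s ≠ 1 := by
  intro h
  have h1 := Complex.norm_natCast_cpow_of_pos (Fact.out : p.Prime).pos s
  rw [h, norm_one] at h1
  have h2 := congrArg Real.log h1
  rw [Real.log_one, Real.log_rpow cast_prime_pos] at h2
  exact mul_ne_zero hs (Real.log_pos one_lt_cast_prime).ne' h2.symm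

theorem norm_cpow_lt_one {s : ℂ} (hs : s.re < 0) : ‖(p : ℂ) ^ s‖ < 1 := by
  have h := Complex.norm_natCast_cpow_of_pos (Fact.out : p.Prime).pos s
  rw [h]
  exact Real.rpow_lt_one_of_one_lt_of_neg one_lt_cast_prime hs

theorem locallyIntegrable_cpow_norm_form (ha : ¬ IsSquare (a : ZMod p)) {s : ℂ} (hs : -2 < s.re) :
    LocallyIntegrable (fun x => ((‖form p a x‖ : ℝ) : ℂ) ^ s) (haar p 4) := by
  refine locallyIntegrable_radial ha (fun m x hx => cpow_norm_form_of_mem_shell s hx)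
    (summable_zpow ?_ ?_)
  · exact cpow_ne_zero (-s)
  · rw [cpow_neg_mul_inv_sq]
    exact norm_cpow_lt_one (by simp; linarith)

/-- The functional equation of `|f|^s`: its Fourier transform is a multiple of `|f°|^{-s-2}`. -/
theorem integral_cpow_norm_form_mul_fourier (ha : ¬ IsSquare (a : ZMod p)) {s : ℂ}
    (hs : -2 < s.re) {ψ : Qn p 4 → ℂ} (hψ : ψ ∈ Psi p 4) :
    ∫ x, ((‖form p a x‖ : ℝ) : ℂ) ^ s * fourier ψ x ∂(haar p 4)
      = (1 - (p : ℂ) ^ s) / (1 - (p : ℂ) ^ (-s - 2)) *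
        ∫ ξ, ((‖formCirc p a ξ‖ : ℝ) : ℂ) ^ (-s - 2) * ψ ξ ∂(haar p 4) := by
  have hlt : ‖(p : ℂ) ^ (-s) * ((p : ℂ) ^ 2)⁻¹‖ < 1 := by
    rw [cpow_neg_mul_inv_sq]
    exact norm_cpow_lt_one (by simp; linarith)
  rw [← integral_const_mul]
  simp only [← mul_assoc]
  refine integral_radial_mul_fourier ha (fun m x hx => cpow_norm_form_of_mem_shell s hx)
    (locallyIntegrable_cpow_norm_form ha hs) (k := fun j =>
      (1 - (p : ℂ) ^ s) / (1 - (p : ℂ) ^ (-s - 2)) * ((p : ℂ) ^ (-s - 2)) ^ j)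
    (fun j ξ hξ => by rw [cpow_norm_formCirc_of_mem_shellCirc _ hξ]) (fun j => ?_) hψ
  have h := hasSum_zpow_mul_shellKernel ?_ hlt j
  · rwa [cpow_neg_mul_inv_sq, ← Complex.cpow_neg, neg_neg] at h
  · exact cpow_ne_zero (-s)

/-! ### The fundamental solution -/

theorem ofReal_one_sub_rpow (t : ℝ) :
    ((1 - (p : ℝ) ^ t : ℝ) : ℂ) = 1 - (p : ℂ) ^ (t : ℂ) := by
  rw [Complex.ofReal_sub, Complex.ofReal_cpow cast_prime_pos.le]
  simp

theorem fundSol_of_ne {α : ℝ} (hα : α ≠ 2) (x : Qn p 4) : fundSol p a α x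
    = (1 - (p : ℂ) ^ (-α : ℂ)) / (1 - (p : ℂ) ^ (α - 2 : ℂ)) *
      ((‖form p a x‖ : ℝ) : ℂ) ^ (α - 2 : ℂ) := by
  rw [fundSol, if_neg hα, Complex.ofReal_mul, Complex.ofReal_div, ofReal_one_sub_rpow,
    ofReal_one_sub_rpow, Complex.ofReal_cpow (norm_nonneg _)]
  push_cast
  rfl

theorem fundSol_two_of_mem_shell {m : ℤ} {x : Qn p 4} (hx : x ∈ shell p a m) :
    fundSol p a 2 x = (1 - ((p : ℂ) ^ 2)⁻¹) * m := by
  have hlog : Real.log p ≠ 0 := (Real.log_pos one_lt_cast_prime).ne'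
  rw [fundSol, if_pos rfl, show ‖form p a x‖ = (p : ℝ) ^ (-m) from hx, Real.log_zpow]
  have : -((1 - (p : ℝ) ^ (-2 : ℝ)) / Real.log p) * (((-m : ℤ) : ℝ) * Real.log p)
      = (1 - ((p : ℝ) ^ 2)⁻¹) * m := by
    rw [Real.rpow_neg cast_prime_pos.le, Real.rpow_two]
    push_cast
    field_simp
  rw [this]
  push_cast
  rfl

theorem symbol_eq_cpow (α : ℝ) (ξ : Qn p 4) :
    symbol p a α ξ = ((‖formCirc p a ξ‖ : ℝ) : ℂ) ^ (α : ℂ) :=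
  Complex.ofReal_cpow (norm_nonneg _) _

theorem locallyIntegrable_fundSol (ha : ¬ IsSquare (a : ZMod p)) {α : ℝ} (hα : 0 < α) :
    LocallyIntegrable (fundSol p a α) (haar p 4) := by
  by_cases h2 : α = 2
  · subst h2
    refine locallyIntegrable_radial ha (fun m x hx => fundSol_two_of_mem_shell hx) fun M => ?_
    refine ((summable_intCast (p := p) M).mul_left ‖1 - ((p : ℂ) ^ 2)⁻¹‖).congr fun n => ?_
    rw [norm_mul, mul_assoc]
  · have h := (locallyIntegrable_cpow_norm_form (p := p) (a := a) ha (s := (α - 2 : ℂ))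
      (by simp [hα])).smul
      ((1 - (p : ℂ) ^ (-α : ℂ)) / (1 - (p : ℂ) ^ (α - 2 : ℂ)))
    refine h.congr (Eventually.of_forall fun x => ?_)
    rw [fundSol_of_ne h2]
    rfl

/-- The Fourier transform of `E_α` is `|f°|^{-α}`. -/
theorem integral_fundSol_mul_fourier (ha : ¬ IsSquare (a : ZMod p)) {α : ℝ} (hα : 0 < α)
    {ψ : Qn p 4 → ℂ} (hψ : ψ ∈ Psi p 4) :
    ∫ x, fundSol p a α x * fourier ψ x ∂(haar p 4)
      = ∫ ξ, symbol p a (-α) ξ * ψ ξ ∂(haar p 4) := by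
  by_cases h2 : α = 2
  · subst h2
    have hb : (1 : ℂ) - ((p : ℂ) ^ 2)⁻¹ ≠ 0 := by
      intro h0
      have := inv_sq_cast_lt_one (p := p)
      rw [← norm_inv_sq_cast, ← sub_eq_zero.mp h0, norm_one] at this
      exact lt_irrefl _ this
    refine integral_radial_mul_fourier ha (fun m x hx => fundSol_two_of_mem_shell hx)
      (locallyIntegrable_fundSol ha hα) (k := fun j => ((p : ℂ) ^ 2)⁻¹ ^ j)
      (fun j ξ hξ => ?_) (fun j => ?_) hψ
    · rw [symbol_eq_cpow, cpow_norm_formCirc_of_mem_shellCirc _ hξ]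
      push_cast
      rw [Complex.cpow_neg, Complex.cpow_ofNat]
    · have h := (hasSum_intCast_mul_shellKernel (p := p) j).mul_left (1 - ((p : ℂ) ^ 2)⁻¹)
      rw [mul_inv_cancel_left₀ hb] at h
      exact h.congr_fun fun m => by rw [mul_assoc]
  · have hne1 : (1 : ℂ) - (p : ℂ) ^ (α - 2 : ℂ) ≠ 0 := by
      refine sub_ne_zero.mpr (cpow_ne_one ?_).symm
      simpa [sub_eq_zero] using h2
    have hne2 : (1 : ℂ) - (p : ℂ) ^ (-α : ℂ) ≠ 0 := by
      refine sub_ne_zero.mpr (cpow_ne_one ?_).symm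
      simpa using hα.ne'
    have h := integral_cpow_norm_form_mul_fourier ha (s := (α - 2 : ℂ)) (by simp [hα]) hψ
    rw [show (-(α - 2 : ℂ) - 2) = -α by ring] at h
    simp only [fundSol_of_ne h2, symbol_eq_cpow, mul_assoc]
    rw [integral_const_mul, h]
    push_cast
    field_simp

theorem symbol_mul_symbol_neg (ha : ¬ IsSquare (a : ZMod p)) (α : ℝ) {ξ : Qn p 4} (hξ : ξ ≠ 0) :
    symbol p a α ξ * symbol p a (-α) ξ = 1 := by
  have hpos : 0 < ‖formCirc p a ξ‖ :=
    norm_pos_iff.mpr fun h => hξ ((formCirc_eq_zero_iff ha ξ).mp h)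
  rw [symbol, symbol, ← Complex.ofReal_mul, ← Real.rpow_add hpos, add_neg_cancel, Real.rpow_zero,
    Complex.ofReal_one]

theorem symbol_apply_neg (α : ℝ) (ξ : Qn p 4) : symbol p a α (-ξ) = symbol p a α ξ := by
  rw [symbol, symbol, formCirc_neg]

theorem modulate_reflect_mem_psi {n : ℕ} {ψ : Qn p n → ℂ} (hψ : ψ ∈ Psi p n) (x : Qn p n) :
    (fun w => chi (x ⬝ᵥ w) * ψ (-w)) ∈ Psi p n := by
  refine ⟨⟨?_, (hψ.1.2.comp_homeomorph (Homeomorph.neg (Qn p n))).mul_left⟩, by simp [hψ.2]⟩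
  have h1 : IsLocallyConstant fun w : Qn p n => chi (x ⬝ᵥ w) := by
    refine chi_isLocallyConstant.comp_continuous (f := fun w : Qn p n => x ⬝ᵥ w) ?_
    simp only [dotProduct]
    fun_prop
  exact h1.mul (hψ.1.1.comp_continuous (f := fun w : Qn p n => -w) continuous_neg)

theorem fourier_modulate_reflect {n : ℕ} (ψ : Qn p n → ℂ) (x y : Qn p n) :
    fourier (fun w => chi (x ⬝ᵥ w) * ψ (-w)) y = fourier ψ (x - y) := by
  rw [fourier, fourier, ← integral_neg_eq_self (fun w => chi (-((x - y) ⬝ᵥ w)) * ψ w) (haar p n)]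
  congr 1
  funext w
  rw [← mul_assoc, ← chi_add]
  congr 2
  rw [dotProduct_neg, sub_dotProduct]
  ring

theorem conv_fundSol (ha : ¬ IsSquare (a : ZMod p)) {α : ℝ} (hα : 0 < α) {ψ : Qn p 4 → ℂ}
    (hψ : ψ ∈ Psi p 4) (x : Qn p 4) :
    ∫ y, fundSol p a α y * fourier ψ (x - y) ∂(haar p 4)
      = fourier (fun ξ => symbol p a (-α) ξ * ψ ξ) x := by
  simp only [← fourier_modulate_reflect]
  rw [integral_fundSol_mul_fourier ha hα (modulate_reflect_mem_psi hψ x), fourier,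
    ← integral_neg_eq_self (fun ξ => chi (-(x ⬝ᵥ ξ)) * (symbol p a (-α) ξ * ψ ξ)) (haar p 4)]
  congr 1
  funext w
  rw [dotProduct_neg, neg_neg, symbol_apply_neg]
  ring

theorem isFundamentalSolution_fundSol (ha : ¬ IsSquare (a : ZMod p)) {α : ℝ} (hα : 0 < α) :
    IsFundamentalSolution p a α (distOf (fundSol p a α) (locallyIntegrable_fundSol ha hα)) := by
  rintro ⟨_, ψ, rfl⟩
  have hu : conv (distOf (fundSol p a α) (locallyIntegrable_fundSol ha hα))
      ⟨fourierOnPsi p 4 ψ, ψ, rfl⟩ = fourier (fun ξ => symbol p a (-α) ξ * ψ.1 ξ) :=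
    funext fun x => conv_fundSol ha hα ψ.2 x
  have hmem := symbol_mul_mem ha (-α) ψ.2
  rw [IsClassicalSolution, hu]
  refine ⟨⟨⟨_, hmem⟩, rfl⟩, ?_⟩
  funext x
  change ∫ ξ, chi (ξ ⬝ᵥ x) * (symbol p a α ξ * fourier (fourier _) ξ) ∂(haar p 4)
    = ∫ ξ, chi (-(x ⬝ᵥ ξ)) * ψ.1 ξ ∂(haar p 4)
  rw [← integral_neg_eq_self (fun ξ => chi (-(x ⬝ᵥ ξ)) * ψ.1 ξ) (haar p 4)]
  congr 1
  funext ξ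
  rw [fourier_fourier ⟨a, ha⟩ hmem.1, dotProduct_neg, neg_neg, dotProduct_comm ξ x,
    symbol_apply_neg]
  rcases eq_or_ne ξ 0 with rfl | hξ
  · simp [ψ.2.2]
  · rw [← mul_assoc (symbol p a α ξ), symbol_mul_symbol_neg ha α hξ, one_mul]

/-! ### Meromorphic continuation and the Bernstein-Sato equation -/

/-- The distribution `|f°|^s` in `Ψ'`. It is defined for every `s`, as functions in `Ψ` vanish near
the origin. -/
def circPower (ha : ¬ IsSquare (a : ZMod p)) (s : ℂ) : PsiDual p 4 where
  toFun ψ := ∫ ξ, ((‖formCirc p a ξ‖ : ℝ) : ℂ) ^ s * ψ.1 ξ ∂(haar p 4)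
  map_add' ψ ψ' := by
    have h : ∀ ψ : Psi p 4,
        Integrable (fun ξ => ((‖formCirc p a ξ‖ : ℝ) : ℂ) ^ s * ψ.1 ξ) (haar p 4) := fun ψ =>
      integrable_of_mem_psi (radial_mul_mem_psi ha
        (fun j ξ hξ => cpow_norm_formCirc_of_mem_shellCirc s hξ) ψ.2)
    rw [← integral_add (h ψ) (h ψ')]
    exact integral_congr_ae (Eventually.of_forall fun ξ => mul_add _ _ _)
  map_smul' c ψ := by
    rw [RingHom.id_apply, smul_eq_mul, ← integral_const_mul]
    exact integral_congr_ae (Eventually.of_forall fun ξ => mul_left_comm _ _ _)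

theorem circPower_apply (ha : ¬ IsSquare (a : ZMod p)) (s : ℂ) (ψ : Psi p 4) :
    circPower ha s ψ = ∫ ξ, ((‖formCirc p a ξ‖ : ℝ) : ℂ) ^ s * ψ.1 ξ ∂(haar p 4) := rfl

theorem differentiable_const_cpow (k : ℂ) : Differentiable ℂ fun s : ℂ => (p : ℂ) ^ (s + k) :=
  fun _ => (differentiableAt_id.add_const k).const_cpow (Or.inl cast_prime_ne_zero)

theorem differentiable_const_cpow_neg (k : ℂ) : Differentiable ℂ fun s : ℂ => (p : ℂ) ^ (-s - k) :=
  fun _ => (differentiableAt_id.neg.sub_const k).const_cpow (Or.inl cast_prime_ne_zero)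

theorem differentiable_circPower (ha : ¬ IsSquare (a : ZMod p)) (ψ : Psi p 4) :
    Differentiable ℂ fun s => circPower ha (-s - 2) ψ := by
  obtain ⟨S, B, hB⟩ := exists_radial_decomposition ha ψ.2
  have h : (fun s => circPower ha (-s - 2) ψ)
      = fun s => ∑ j ∈ S, ((p : ℂ) ^ (-s - 2)) ^ j * B j :=
    funext fun s => hB _ _ fun j ξ hξ => cpow_norm_formCirc_of_mem_shellCirc _ hξ
  rw [h]
  refine Differentiable.fun_sum fun j _ s => ?_
  exact ((differentiable_const_cpow_neg 2 s).zpow (Or.inl (cpow_ne_zero _))).mul_const _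

/-- `|f|^s` as an element of `Φ'`, given for every `s` by the functional equation. At the points with
`p^{s+2} = 1` division by zero makes it `0`, a value without significance. -/
def formPower (ha : ¬ IsSquare (a : ZMod p)) (s : ℂ) : PhiDual p 4 :=
  ((1 - (p : ℂ) ^ s) / (1 - (p : ℂ) ^ (-s - 2))) •
    (circPower ha (-s - 2)) ∘ₗ (fourierPsiPhi p 4).symm.toLinearMap

theorem formPower_apply (ha : ¬ IsSquare (a : ZMod p)) (s : ℂ) (ψ : Psi p 4) :
    formPower ha s (fourierPsiPhi p 4 ψ)
      = (1 - (p : ℂ) ^ s) / (1 - (p : ℂ) ^ (-s - 2)) * circPower ha (-s - 2) ψ := by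
  simp [formPower]

theorem one_sub_cpow_neg_ne_zero {p : ℕ} {s k : ℂ} (h : (p : ℂ) ^ (s + k) ≠ 1) :
    1 - (p : ℂ) ^ (-s - k) ≠ 0 := by
  rw [show -s - k = -(s + k) by ring, Complex.cpow_neg]
  exact sub_ne_zero.mpr fun h0 => h (inv_eq_one.mp h0.symm)

theorem isMeromorphicContinuation_formPower (ha : ¬ IsSquare (a : ZMod p)) :
    IsMeromorphicContinuation p a (formPower ha) := by
  have hnum : Differentiable ℂ fun s : ℂ => 1 - (p : ℂ) ^ s := by
    simpa using (differentiable_const_cpow (p := p) 0).const_sub 1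
  have hden : Differentiable ℂ fun s : ℂ => 1 - (p : ℂ) ^ (-s - 2) :=
    (differentiable_const_cpow_neg 2).const_sub 1
  refine ⟨fun s hs φ => ?_, fun φ s _ => ?_, fun φ s hs => ?_⟩
  · obtain ⟨ψ, rfl⟩ := (fourierPsiPhi p 4).surjective φ
    rw [formPower_apply, circPower_apply,
      ← integral_cpow_norm_form_mul_fourier ha (by linarith) ψ.2]
    refine (setIntegral_eq_integral_of_forall_compl_eq_zero fun x hx => ?_).symm
    have h0 : form p a x = 0 := not_not.mp hx
    have hs0 : s ≠ 0 := by
      rintro rfl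
      simp at hs
    rw [h0, norm_zero, Complex.ofReal_zero, Complex.zero_cpow hs0, zero_mul]
  · obtain ⟨ψ, rfl⟩ := (fourierPsiPhi p 4).surjective φ
    simp only [formPower_apply]
    exact ((hnum.analyticAt s).meromorphicAt.div (hden.analyticAt s).meromorphicAt).mul
      ((differentiable_circPower ha ψ).analyticAt s).meromorphicAt
  · obtain ⟨ψ, rfl⟩ := (fourierPsiPhi p 4).surjective φ
    simp only [formPower_apply]
    exact ((hnum.analyticAt s).div (hden.analyticAt s) (one_sub_cpow_neg_ne_zero hs)).mul
      ((differentiable_circPower ha ψ).analyticAt s)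

theorem isPreconnected_setOf_cpow_ne_one :
    IsPreconnected {s : ℂ | (p : ℂ) ^ (s + 2) ≠ 1} := by
  have hlog : Complex.log (p : ℂ) ≠ 0 := by
    rw [← Complex.natCast_log]
    exact_mod_cast (Real.log_pos (one_lt_cast_prime (p := p))).ne'
  have hc : {s : ℂ | (p : ℂ) ^ (s + 2) = 1}.Countable := by
    have h1 : (Complex.exp ⁻¹' {1}).Countable := (Set.countable_singleton _).preimage_cexp
    have h2 := h1.preimage (f := fun s : ℂ => Complex.log p * (s + 2)) fun s t h =>
      add_right_cancel (mul_left_cancel₀ hlog h)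
    refine h2.mono fun s hs => ?_
    rw [Set.mem_ofPred_eq, Complex.cpow_def_of_ne_zero cast_prime_ne_zero] at hs
    exact hs
  exact (hc.isPathConnected_compl_of_one_lt_rank
    (by rw [Complex.rank_real_complex]; norm_num)).isConnected.isPreconnected

/-- Uniqueness of the meromorphic continuation. -/
theorem IsMeromorphicContinuation.eq_of_cpow_ne_one {Z Z' : ℂ → PhiDual p 4}
    (hZ : IsMeromorphicContinuation p a Z) (hZ' : IsMeromorphicContinuation p a Z') {s : ℂ}
    (hs : (p : ℂ) ^ (s + 2) ≠ 1) : Z s = Z' s := by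
  ext φ
  have hone : (p : ℂ) ^ ((1 : ℂ) + 2) ≠ 1 := cpow_ne_one (by norm_num)
  refine AnalyticOnNhd.eqOn_of_preconnected_of_eventuallyEq (z₀ := 1)
    (f := fun s => Z s φ) (g := fun s => Z' s φ)
    (fun t ht => hZ.analyticAt φ t ht) (fun t ht => hZ'.analyticAt φ t ht)
    isPreconnected_setOf_cpow_ne_one hone ?_ hs
  have hre : ∀ᶠ t : ℂ in 𝓝 1, 0 < t.re :=
    (isOpen_lt continuous_const Complex.continuous_re).mem_nhds (by simp)
  filter_upwards [hre] with t ht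
  rw [hZ.eq_integral t ht, hZ'.eq_integral t ht]

theorem pseudoDiffDual_apply (ha : ¬ IsSquare (a : ZMod p)) (α : ℝ) (J : PhiDual p 4)
    (ψ : Psi p 4) : pseudoDiffDual ha α J (fourierPsiPhi p 4 ψ)
      = J (fourierPsiPhi p 4 (mulSymbol ha α ψ)) := by
  simp [pseudoDiffDual, fourierDual, LinearEquiv.dualMap_symm]

theorem circPower_mulSymbol_one (ha : ¬ IsSquare (a : ZMod p)) (s : ℂ) (ψ : Psi p 4) :
    circPower ha s (mulSymbol ha 1 ψ) = circPower ha (s + 1) ψ := by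
  rw [circPower_apply, circPower_apply]
  congr 1
  funext ξ
  change _ * (symbol p a 1 ξ * ψ.1 ξ) = _
  rcases eq_or_ne ξ 0 with rfl | hξ
  · simp [ψ.2.2]
  · have hne : ((‖formCirc p a ξ‖ : ℝ) : ℂ) ≠ 0 := by
      exact_mod_cast norm_ne_zero_iff.mpr fun h => hξ ((formCirc_eq_zero_iff ha ξ).mp h)
    rw [symbol_eq_cpow, Complex.ofReal_one, ← mul_assoc, ← Complex.cpow_add _ _ hne]

theorem pseudoDiffDual_formPower (ha : ¬ IsSquare (a : ZMod p)) (s : ℂ) (ψ : Psi p 4) :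
    pseudoDiffDual ha 1 (formPower ha (s + 1)) (fourierPsiPhi p 4 ψ)
      = (1 - (p : ℂ) ^ (s + 1)) / (1 - (p : ℂ) ^ (-s - 3)) * circPower ha (-s - 2) ψ := by
  rw [pseudoDiffDual_apply, formPower_apply, circPower_mulSymbol_one]
  congr 4 <;> ring

theorem bFactor_mul_formPower (ha : ¬ IsSquare (a : ZMod p)) {s : ℂ} (h0 : (p : ℂ) ^ s ≠ 1)
    (h2 : (p : ℂ) ^ (s + 2) ≠ 1) (ψ : Psi p 4) :
    bFactor p s * formPower ha s (fourierPsiPhi p 4 ψ)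
      = (1 - (p : ℂ) ^ (s + 1)) / (1 - (p : ℂ) ^ (-s - 3)) * circPower ha (-s - 2) ψ := by
  have k0 : 1 - (p : ℂ) ^ s ≠ 0 := sub_ne_zero.mpr h0.symm
  have k2 := one_sub_cpow_neg_ne_zero h2
  rw [formPower_apply, bFactor, ← mul_assoc]
  congr 1
  rw [div_mul_div_comm, mul_assoc, mul_assoc,
    mul_comm (1 - (p : ℂ) ^ (-s - 2)), mul_div_mul_right _ _ (mul_ne_zero k0 k2)]

theorem eventually_cpow_ne_one (s₀ k : ℂ) : ∀ᶠ s in 𝓝[≠] s₀, (p : ℂ) ^ (s + k) ≠ 1 := by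
  have hlog : Complex.log (p : ℂ) ≠ 0 := by
    rw [← Complex.natCast_log]
    exact_mod_cast (Real.log_pos (one_lt_cast_prime (p := p))).ne'
  have h : HasDerivAt (fun s : ℂ => (p : ℂ) ^ (s + k)) _ s₀ :=
    ((hasDerivAt_id s₀).add_const k).const_cpow (Or.inl cast_prime_ne_zero)
  exact h.eventually_ne (mul_ne_zero (mul_ne_zero (cpow_ne_zero _) hlog) one_ne_zero)

end PadicRiesz

end

theorem theorem3p2 (p : ℕ) [Fact p.Prime] (hp : p ≠ 2) (a : ℤ) (ha : ¬ IsSquare (a : ZMod p)) :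
    (∀ α : ℝ, 0 < α →
      ∃ hE : MeasureTheory.LocallyIntegrable (PadicRiesz.fundSol p a α) (PadicRiesz.haar p 4),
        PadicRiesz.IsFundamentalSolution p a α (PadicRiesz.distOf (PadicRiesz.fundSol p a α) hE)) ∧
    (∃ Z : ℂ → PadicRiesz.PhiDual p 4, PadicRiesz.IsMeromorphicContinuation p a Z) ∧
    (∀ Z : ℂ → PadicRiesz.PhiDual p 4, PadicRiesz.IsMeromorphicContinuation p a Z →
      (∀ s : ℂ, (p : ℂ) ^ s ≠ 1 → (p : ℂ) ^ (s + 2) ≠ 1 → (p : ℂ) ^ (s + 3) ≠ 1 →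
        PadicRiesz.pseudoDiffDual ha 1 (Z (s + 1)) = PadicRiesz.bFactor p s • Z s) ∧
      (∀ s₀ : ℂ, (p : ℂ) ^ (s₀ + 3) ≠ 1 → ∀ φ : PadicRiesz.Phi p 4,
        Filter.Tendsto (fun s : ℂ => PadicRiesz.bFactor p s * Z s φ) (nhdsWithin s₀ {s₀}ᶜ)
          (nhds (PadicRiesz.pseudoDiffDual ha 1 (Z (s₀ + 1)) φ)))) := by
  have hF := PadicRiesz.isMeromorphicContinuation_formPower ha
  refine ⟨fun α hα => ⟨PadicRiesz.locallyIntegrable_fundSol ha hα,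
    PadicRiesz.isFundamentalSolution_fundSol ha hα⟩, ⟨_, hF⟩, fun Z hZ => ?_⟩
  have hsucc : ∀ s : ℂ, (p : ℂ) ^ (s + 3) ≠ 1 → Z (s + 1) = PadicRiesz.formPower ha (s + 1) :=
    fun s hs => hZ.eq_of_cpow_ne_one hF (by rwa [show s + 1 + 2 = s + 3 by ring])
  refine ⟨fun s h0 h2 h3 => ?_, fun s₀ h3 φ => ?_⟩
  · rw [hsucc s h3, hZ.eq_of_cpow_ne_one hF h2]
    ext φ
    obtain ⟨ψ, rfl⟩ := (PadicRiesz.fourierPsiPhi p 4).surjective φ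
    rw [PadicRiesz.pseudoDiffDual_formPower, LinearMap.smul_apply, smul_eq_mul,
      PadicRiesz.bFactor_mul_formPower ha h0 h2]
  · obtain ⟨ψ, rfl⟩ := (PadicRiesz.fourierPsiPhi p 4).surjective φ
    rw [hsucc s₀ h3, PadicRiesz.pseudoDiffDual_formPower]
    have hcont : ContinuousAt (fun s : ℂ => (1 - (p : ℂ) ^ (s + 1)) / (1 - (p : ℂ) ^ (-s - 3)) *
        PadicRiesz.circPower ha (-s - 2) ψ) s₀ :=
      ((((PadicRiesz.differentiable_const_cpow (p := p) 1).const_sub 1).continuous.continuousAt).div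
        (((PadicRiesz.differentiable_const_cpow_neg (p := p) 3).const_sub 1).continuous.continuousAt)
        (PadicRiesz.one_sub_cpow_neg_ne_zero h3)).mul
        (PadicRiesz.differentiable_circPower ha ψ).continuous.continuousAt
    refine (hcont.tendsto.mono_left nhdsWithin_le_nhds).congr' ?_
    filter_upwards [PadicRiesz.eventually_cpow_ne_one (p := p) s₀ 0,
      PadicRiesz.eventually_cpow_ne_one (p := p) s₀ 2] with s h0 h2
    rw [add_zero] at h0
    rw [hZ.eq_of_cpow_ne_one hF h2, PadicRiesz.bFactor_mul_formPower ha h0 h2]
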